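/- All graphs are finite simple graphs, with vertices numbered $0,\dots,n-1$; a graph is given to an algorithm by its adjacency matrix. A *based oriented cycle* in a graph $G$ with basepoint $v$ is a closed walk in $G$ from $v$ to $v$, i.e. a finite sequence of vertices starting and ending at $v$ in which consecutive vertices are adjacent (repetitions are allowed, and so is the one-vertex walk $v$). An *oriented cycle* is a closed walk considered up to cyclic shift, i.e. with its basepoint forgotten. An *elementary cancellation* replaces three consecutive vertices $a,b,a$ of a walk by $a$, keeping its endpoints; for oriented cycles, it is an elementary cancellation of some representing closed walks. Two based oriented cycles with basepoint $v$ are *based homotopic* (two oriented cycles are *freely homotopic*) if they are joined by a finite sequence of based oriented cycles with basepoint $v$ (respectively, of oriented cycles) such that of any two consecutive ones, one is obtained from the other by an elementary cancellation. A *simplicial map* from $G$ to $H$ is a map of vertices sending adjacent vertices to equal or adjacent ones; two simplicial maps are *homotopic* if the continuous maps $|G|\to|H|$ of geometric realizations which they induce are homotopic. **Theorem 8.10.** (a) There is an algorithm which, given a graph $G$ and two based oriented cycles in $G$ with a common basepoint (as lists of vertices), decides whether they are based homotopic. (b) There is an algorithm which, given a graph $G$ and two oriented cycles in $G$ (as lists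 of vertices of representing closed walks), decides whether they are freely homotopic. (c) There is an algorithm which, given graphs $G,H$ and two simplicial maps $G\to H$ (as lists of images of the vertices), decides whether they are homotopic. In particular, there are such algorithms for each fixed graph $G$ in (a) and (b), and for each fixed pair $G,H$ in (c). An algorithm means a total computable function. -/

import Mathlib

/-! Graphs are finite simple graphs, given on the vertex set `Fin n`.  A based oriented cycle is a
closed walk (vertices and edges may be repeated, and the one-vertex walk `nil` is allowed). -/

namespace GraphHomotopy

open SimpleGraph

section Cycles

variable {V : Type*} {G : SimpleGraph V}

/-- `ElementaryCancellation p q`: the walk `q` is obtained from the walk `p` by one elementary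
cancellation, that is, by replacing some consecutive vertices `a, b, a` of `p` by `a`. The
endpoints are not changed. -/
inductive ElementaryCancellation {u v : V} : G.Walk u v → G.Walk u v → Prop
  | mk {a b : V} (p : G.Walk u a) (h : G.Adj a b) (q : G.Walk a v) :
      ElementaryCancellation (p.append (Walk.cons h (Walk.cons h.symm q))) (p.append q)

/-- Two closed walks with the same basepoint `v` are based homotopic if they are joined by a finite
sequence of closed walks based at `v`, such that of any two consecutive ones
one is obtained from the other by an elementary cancellation. -/
def BasedHomotopic {v : V} (p q : G.Walk v v) : Prop :=
  Relation.EqvGen ElementaryCancellation p q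

/-- `CyclicShift c d`: the closed walk `d` is obtained from `c` by moving the basepoint along
`c`. -/
inductive CyclicShift : (Σ v : V, G.Walk v v) → (Σ v : V, G.Walk v v) → Prop
  | mk {u v : V} (p : G.Walk u v) (q : G.Walk v u) :
      CyclicShift ⟨u, p.append q⟩ ⟨v, q.append p⟩

variable (G) in
/-- An oriented cycle in `G` is a closed walk considered up to a cyclic shift. -/
def OrientedCycle : Type _ :=
  Quot (CyclicShift (G := G))

/-- The oriented cycle obtained from a based oriented cycle by forgetting the basepoint. -/
def OrientedCycle.mk {v : V} (p : G.Walk v v) : OrientedCycle G :=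
  Quot.mk _ ⟨v, p⟩

/-- An elementary cancellation of oriented cycles is an elementary cancellation of closed walks
representing them. -/
def OrientedCycle.Cancellation (c d : OrientedCycle G) : Prop :=
  ∃ (v : V) (p q : G.Walk v v),
    c = OrientedCycle.mk p ∧ d = OrientedCycle.mk q ∧ ElementaryCancellation p q

/-- Two oriented cycles are (freely) homotopic if they are joined by a finite sequence of
oriented cycles such that of any two consecutive ones one is obtained from the other by an
elementary cancellation. -/
def OrientedCycle.Homotopic (c d : OrientedCycle G) : Prop :=
  Relation.EqvGen OrientedCycle.Cancellation c d

end Cycles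

section Maps

variable {V W : Type*} [Fintype V] [Fintype W]

/-- The geometric realization of a finite graph: the points of the standard simplex on the
vertex set whose support is contained in a vertex or in an edge. It has the topology induced from
`V → ℝ`. -/
def realization (G : SimpleGraph V) : Set (stdSimplex ℝ V) :=
  {x | ∃ a b : V, (a = b ∨ G.Adj a b) ∧ ∀ v, x v ≠ 0 → v = a ∨ v = b}

/-- A simplicial map of graphs sends the ends of each edge to equal or adjacent vertices. -/
structure SimplicialMap {V W : Type*} (G : SimpleGraph V) (H : SimpleGraph W) where
  toFun : V → W
  map_adj : ∀ a b, G.Adj a b → toFun a = toFun b ∨ H.Adj (toFun a) (toFun b)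

theorem SimplicialMap.map_mem_realization {G : SimpleGraph V} {H : SimpleGraph W}
    (f : SimplicialMap G H) (x : stdSimplex ℝ V) (hx : x ∈ realization G) :
    stdSimplex.map f.toFun x ∈ realization H := by
  classical
  obtain ⟨a, b, hab, h⟩ := hx
  refine ⟨f.toFun a, f.toFun b, ?_, fun w hw => ?_⟩
  · rcases hab with rfl | hab
    · exact Or.inl rfl
    · exact f.map_adj a b hab
  · rw [stdSimplex.map_coe, FunOnFinite.linearMap_apply_apply] at hw
    obtain ⟨v, hv, hv0⟩ := Finset.exists_ne_zero_of_sum_ne_zero hw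
    rw [← (Finset.mem_filter.1 hv).2]
    rcases h v hv0 with rfl | rfl
    · exact Or.inl rfl
    · exact Or.inr rfl

/-- The continuous map of geometric realizations induced by a simplicial map: it is given by the
simplicial map on the vertices and is affine on each edge. -/
noncomputable def SimplicialMap.realize {G : SimpleGraph V} {H : SimpleGraph W}
    (f : SimplicialMap G H) : C(realization G, realization H) where
  toFun x := ⟨stdSimplex.map f.toFun x.1, f.map_mem_realization x.1 x.2⟩
  continuous_toFun :=
    ((stdSimplex.continuous_map f.toFun).comp continuous_subtype_val).subtype_mk _

/-- Two simplicial maps are homotopic if the induced maps of geometric realizations are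
homotopic as continuous maps. -/
def SimplicialMap.Homotopic {G : SimpleGraph V} {H : SimpleGraph W}
    (f g : SimplicialMap G H) : Prop :=
  ContinuousMap.Homotopic f.realize g.realize

end Maps

/-! Finite codes of the objects above, used as inputs of algorithms. -/

section Codes

open scoped Classical in
/-- The code of a graph is its adjacency matrix, the list of its rows. -/
noncomputable def graphCode {n : ℕ} (G : SimpleGraph (Fin n)) : List (List Bool) :=
  List.ofFn fun i => List.ofFn fun j => decide (G.Adj i j)

/-- The code of a walk is the list of the vertices that it visits in turn. A closed walk based at
`v` is coded by a list which begins and ends with `v`. -/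
def walkCode {n : ℕ} {G : SimpleGraph (Fin n)} {u v : Fin n} (p : G.Walk u v) : List ℕ :=
  p.support.map Fin.val

/-- The code of a simplicial map is the list of the images of the vertices `0, 1, …, n - 1`. -/
def mapCode {n m : ℕ} {G : SimpleGraph (Fin n)} {H : SimpleGraph (Fin m)}
    (f : SimplicialMap G H) : List ℕ :=
  List.ofFn fun i => (f.toFun i : ℕ)

end Codes

end GraphHomotopy

/-! A walk is treated as a word in the vertices, modulo `a, a ↦ a` and `a, b, a ↦ a`. Every word has
a unique reduced form, computed from right to left by `push`, and `WordEquiv` is a congruence for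
concatenation in which reversal acts as inversion. The rule `a, a ↦ a` admits lazy walks and lets
words be concatenated without bookkeeping of the shared vertex. On walks of the graph this
equivalence is exactly based homotopy (`basedHomotopic_iff`), so (a) is a comparison of reduced
forms.

Free homotopy is conjugacy by a walk between the basepoints (`orientedCycle_homotopic_iff`), as in a
free group. The search for a conjugator, even a simultaneous one for a finite family, can be
bounded. Along a reduced conjugator the lengths of the partial conjugates never exceed the larger of
the lengths at the two ends (`length_conj_le_max`), so only finitely many tuples of partial
conjugates can occur. In a shortest conjugator no tuple occurs twice, since the piece in between
could be cut out (`IsConjugator.exists_length_le`). Part (b) is the case of a single pair.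

For (c), a homotopy from `f` to `g` amounts to path classes from `f v` to `g v` that are natural
with respect to edges. One direction samples the homotopy on a fine grid
(`exists_words_of_homotopic`); the other fills a square over each edge and glues
(`homotopic_of_natural`). Naturality can be spread out from one base vertex in each component, so it
becomes simultaneous conjugacy of the images of closed walks, and finitely many short ones suffice
(`simplicialMap_homotopic_iff`). All the resulting tests are bounded searches, hence primitive
recursive. -/

namespace GraphHomotopy

/-! ### Reduced words and the congruence they define. -/

section Words

section

variable {α : Type*}

/-- A list of vertices without repetitions `a, a` and spikes `a, b, a`. -/
def IsReduced : List α → Prop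
  | [] => True
  | [_] => True
  | a :: b :: t => a ≠ b ∧ t.head? ≠ some a ∧ IsReduced (b :: t)

theorem IsReduced.tail {a : α} {s : List α} (h : IsReduced (a :: s)) : IsReduced s := by
  cases s with
  | nil => trivial
  | cons b t => exact h.2.2

end

variable {α : Type*} [DecidableEq α]

/-- Put the letter `a` in front of a reduced word and reduce: a repetition `a, a` becomes `a`, and a
spike `a, b, a` becomes `a`. -/
def push (a : α) : List α → List α
  | [] => [a]
  | b :: t => if a = b then b :: t else if t.head? = some a then t else a :: b :: t

/-- The reduced form of a list of vertices with respect to `a, a ↦ a` and `a, b, a ↦ a`. -/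
def reduce (l : List α) : List α := l.foldr push []

theorem IsReduced.push {a : α} {s : List α} (h : IsReduced s) : IsReduced (push a s) := by
  match s with
  | [] => trivial
  | b :: t =>
    rw [GraphHomotopy.push]
    split_ifs with h1 h2
    · exact h
    · exact h.tail
    · exact ⟨h1, h2, h⟩

theorem isReduced_foldr_push {s : List α} (h : IsReduced s) (p : List α) :
    IsReduced (p.foldr push s) := by
  induction p with
  | nil => exact h
  | cons a p ih => exact ih.push

theorem isReduced_reduce (l : List α) : IsReduced (reduce l) :=
  isReduced_foldr_push (s := []) trivial l

theorem push_of_isReduced {a : α} {s : List α} (h : IsReduced (a :: s)) : push a s = a :: s := by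
  cases s with
  | nil => rfl
  | cons b t => rw [push, if_neg h.1, if_neg h.2.1]

theorem IsReduced.reduce_eq {l : List α} (h : IsReduced l) : reduce l = l := by
  induction l with
  | nil => rfl
  | cons a l ih =>
    rw [reduce, List.foldr_cons, ← reduce, ih h.tail, push_of_isReduced h]

theorem head?_push (a : α) (s : List α) : (push a s).head? = some a := by
  match s with
  | [] => rfl
  | b :: t => rw [push]; split_ifs with h1 h2 <;> simp_all

theorem push_push (a : α) (s : List α) : push a (push a s) = push a s := by
  have := head?_push a s
  match h : push a s with
  | [] => simp_all
  | b :: t => simp_all [push]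

/-- The relation `a, b, a ↦ a` as an identity of operators. Pushing `b` may itself cancel;
reducedness is what ensures that pushing `a` back then restores the word instead of cancelling
further. -/
theorem push_push_push (a b : α) {s : List α} (hs : IsReduced s) :
    push a (push b (push a s)) = push a s := by
  have h1 := head?_push a s
  have h2 := hs.push (a := a)
  match h : push a s with
  | [] => simp_all
  | c :: t =>
    rw [h] at h1 h2
    obtain rfl : c = a := by simpa using h1
    by_cases hb : b = c
    · subst hb; simp [push]
    by_cases ht : t.head? = some b
    · obtain ⟨u, rfl⟩ : ∃ u, t = b :: u := by
        cases t with
        | nil => simp at ht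
        | cons x u => exact ⟨u, by simp_all⟩
      have : u.head? ≠ some c := h2.2.1
      simp [push, hb, this, Ne.symm hb]
    · simp [push, hb, ht, Ne.symm hb]

theorem getLast?_push (a : α) {s : List α} (hs : s ≠ []) :
    (push a s).getLast? = s.getLast? := by
  match s with
  | [b] => rw [push]; split_ifs <;> simp_all
  | b :: c :: t => rw [push]; split_ifs <;> simp_all

theorem length_push_le (a : α) (s : List α) : (push a s).length ≤ s.length + 1 := by
  match s with
  | [] => simp [push]
  | b :: t => rw [push]; split_ifs <;> simp; omega

theorem reduce_cons (a : α) (l : List α) : reduce (a :: l) = push a (reduce l) := rfl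

theorem length_reduce_le (l : List α) : (reduce l).length ≤ l.length := by
  induction l with
  | nil => simp [reduce]
  | cons a l ih =>
    have := length_push_le a (reduce l)
    rw [reduce_cons, List.length_cons]; omega

theorem head?_reduce (l : List α) : (reduce l).head? = l.head? := by
  cases l with
  | nil => rfl
  | cons a l => simp [reduce_cons, head?_push]

theorem reduce_eq_nil {l : List α} : reduce l = [] ↔ l = [] := by
  rw [← List.head?_eq_none_iff, head?_reduce, List.head?_eq_none_iff]

theorem getLast?_reduce (l : List α) : (reduce l).getLast? = l.getLast? := by
  induction l with
  | nil => rfl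
  | cons a l ih =>
    cases l with
    | nil => rfl
    | cons b l =>
      rw [reduce_cons, getLast?_push, ih, List.getLast?_cons_cons]
      simp [reduce_eq_nil]

theorem reduce_append (p q : List α) : reduce (p ++ q) = p.foldr push (reduce q) := by
  simp [reduce, List.foldr_append]

/-- Each cancelling case of `push a p` is one of the operator identities `push_push`,
`push_push_push`. Hence the action of a word on reduced words depends only on its reduced form,
which makes `WordEquiv` a congruence. -/
theorem foldr_push_push {s : List α} (hs : IsReduced s) (a : α) {p : List α}
    (hp : IsReduced p) : (push a p).foldr push s = push a (p.foldr push s) := by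
  match p with
  | [] => rfl
  | [b] =>
    rw [push]
    split_ifs with h1 h2
    · subst h1; simp [push_push]
    · simp at h2
    · rfl
  | b :: c :: t =>
    rw [push]
    split_ifs with h1 h2
    · subst h1; simp [push_push]
    · obtain rfl : c = a := by simpa using h2
      simp only [List.foldr_cons]
      rw [push_push_push]
      exact isReduced_foldr_push hs t
    · rfl

theorem foldr_push_reduce {s : List α} (hs : IsReduced s) (p : List α) :
    (reduce p).foldr push s = p.foldr push s := by
  induction p with
  | nil => rfl
  | cons a p ih =>
    rw [reduce_cons, foldr_push_push hs a (isReduced_reduce p), ih, List.foldr_cons]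

/-- Two lists of vertices are equivalent if they have the same reduced form. -/
def WordEquiv (p q : List α) : Prop := reduce p = reduce q

theorem equiv_reduce (p : List α) : WordEquiv (reduce p) p := (isReduced_reduce p).reduce_eq

theorem WordEquiv.append {p p' q q' : List α} (hp : WordEquiv p p') (hq : WordEquiv q q') :
    WordEquiv (p ++ q) (p' ++ q') := by
  unfold WordEquiv at *
  rw [reduce_append, reduce_append, hq, ← foldr_push_reduce (isReduced_reduce q') p, hp,
    foldr_push_reduce (isReduced_reduce q')]

theorem WordEquiv.refl (p : List α) : WordEquiv p p := rfl

theorem WordEquiv.symm {p q : List α} (h : WordEquiv p q) : WordEquiv q p := Eq.symm h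

theorem WordEquiv.trans {p q r : List α} (h : WordEquiv p q) (h' : WordEquiv q r) : WordEquiv p r := Eq.trans h h'

instance : Trans (WordEquiv (α := α)) (WordEquiv (α := α)) (WordEquiv (α := α)) := ⟨WordEquiv.trans⟩

theorem WordEquiv.append_left (p : List α) {q q' : List α} (h : WordEquiv q q') :
    WordEquiv (p ++ q) (p ++ q') := (WordEquiv.refl p).append h

theorem WordEquiv.append_right {p p' : List α} (h : WordEquiv p p') (q : List α) :
    WordEquiv (p ++ q) (p' ++ q) := h.append (WordEquiv.refl q)

theorem WordEquiv.cons (a : α) {q q' : List α} (h : WordEquiv q q') : WordEquiv (a :: q) (a :: q') :=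
  h.append_left [a]

theorem equiv_repeat (a : α) : WordEquiv [a, a] [a] := by simp [WordEquiv, reduce, push]

theorem equiv_spike (a b : α) : WordEquiv [a, b, a] [a] := push_push_push a b (s := []) trivial

theorem wordEquiv_iff_of_isReduced {p q : List α} (hp : IsReduced p) (hq : IsReduced q) :
    WordEquiv p q ↔ p = q := by rw [WordEquiv, hp.reduce_eq, hq.reduce_eq]

/-- A repeated letter at the junction of two words may be dropped. -/
theorem equiv_junction (p q : List α) (a : α) : WordEquiv (p ++ [a] ++ a :: q) (p ++ a :: q) := by
  have := ((equiv_repeat a).append_left p).append_right q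
  simpa using this

/-- Cancellation proceeds outwards from the middle, where `b, a, a, b` becomes `b, b`; only the
outermost letter survives. -/
theorem equiv_reverse_append_cons (p : List α) (a : α) :
    ∀ q : List α, WordEquiv (q ++ (a :: p).reverse ++ (a :: p)) (q ++ [p.getLastD a]) := by
  induction p generalizing a with
  | nil => intro q; simpa using equiv_junction q [] a
  | cons b p ih =>
    intro q
    have h := ((equiv_repeat a).cons b).append_right [b]
    have h' : WordEquiv [b, a, a, b] [b, b] :=
      h.trans ((equiv_spike b a).trans (equiv_repeat b).symm)
    have h2 := (h'.append_left (q ++ p.reverse)).append_right p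
    have h3 := ih b q
    simp only [List.reverse_cons, List.append_assoc, List.cons_append, List.nil_append,
      List.getLastD_cons] at h2 h3 ⊢
    exact h2.trans h3

theorem equiv_reverse_append {p : List α} {a : α} (h : p.getLast? = some a) :
    WordEquiv (p.reverse ++ p) [a] := by
  cases p with
  | nil => simp at h
  | cons b p =>
    have := equiv_reverse_append_cons p b []
    rw [List.getLast?_cons, Option.some.injEq] at h
    simpa [List.getLastD_eq_getLast?, h] using this

theorem equiv_append_reverse {p : List α} {a : α} (h : p.head? = some a) :
    WordEquiv (p ++ p.reverse) [a] := by
  have := equiv_reverse_append (p := p.reverse) (a := a) (by simpa using h)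
  simpa using this

theorem equiv_cons_of_head? {p : List α} {a : α} (h : p.head? = some a) : WordEquiv (a :: p) p := by
  obtain ⟨t, rfl⟩ : ∃ t, p = a :: t := by
    cases p with
    | nil => simp at h
    | cons b t => exact ⟨t, by simp_all⟩
  exact (equiv_repeat a).append_right t

theorem equiv_concat_of_getLast? {p : List α} {a : α} (h : p.getLast? = some a) :
    WordEquiv (p ++ [a]) p := by
  obtain ⟨t, rfl⟩ : ∃ t, p = t ++ [a] := ⟨p.dropLast, (List.dropLast_append_getLast? a h).symm⟩
  simpa using equiv_junction t [] a

theorem WordEquiv.head?_eq {p q : List α} (h : WordEquiv p q) : p.head? = q.head? := by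
  rw [← head?_reduce, h, head?_reduce]

theorem WordEquiv.getLast?_eq {p q : List α} (h : WordEquiv p q) : p.getLast? = q.getLast? := by
  rw [← getLast?_reduce, h, getLast?_reduce]

/-- Reduction of `p⁻¹ a p` against conjugating back by `p`. -/
theorem conj_equiv_iff {p a b : List α} {x y : α} (hp : p.head? = some x)
    (hp' : p.getLast? = some y) (ha : a.head? = some x) (hb : b.head? = some y) :
    WordEquiv (p.reverse ++ a ++ p) b ↔ WordEquiv (a ++ p) (p ++ b) := by
  constructor
  · intro h
    calc WordEquiv (a ++ p) (x :: (a ++ p)) := (equiv_cons_of_head? (by simp [ha])).symm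
      WordEquiv _ (p ++ (p.reverse ++ a ++ p)) := by
        have := (equiv_append_reverse hp).symm.append_right (a ++ p)
        simpa using this
      WordEquiv _ (p ++ b) := h.append_left p
  · intro h
    calc WordEquiv (p.reverse ++ a ++ p) (p.reverse ++ (p ++ b)) := by
          simpa using h.append_left p.reverse
      WordEquiv _ (y :: b) := by
        have := (equiv_reverse_append hp').append_right b
        simpa using this
      WordEquiv _ b := equiv_cons_of_head? hb

theorem map_push {β : Type*} [DecidableEq β] {f : α → β} (hf : Function.Injective f) (a : α)
    (s : List α) : (push a s).map f = push (f a) (s.map f) := by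
  match s with
  | [] => rfl
  | [b] => simp only [push, List.map_cons]; split_ifs <;> simp_all [hf.eq_iff]
  | b :: c :: t =>
    simp only [push, List.map_cons]; split_ifs <;> simp_all [hf.eq_iff]

theorem reduce_map {β : Type*} [DecidableEq β] {f : α → β} (hf : Function.Injective f)
    (l : List α) : reduce (l.map f) = (reduce l).map f := by
  induction l with
  | nil => rfl
  | cons a l ih => rw [List.map_cons, reduce_cons, reduce_cons, ih, map_push hf]

/-- Used to pass between vertices in `Fin n` and their numerical codes. -/
theorem equiv_map_iff {β : Type*} [DecidableEq β] {f : α → β} (hf : Function.Injective f)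
    {p q : List α} : WordEquiv (p.map f) (q.map f) ↔ WordEquiv p q := by
  rw [WordEquiv, reduce_map hf, reduce_map hf, (List.map_injective_iff.2 hf).eq_iff, WordEquiv]

end Words
end GraphHomotopy

namespace GraphHomotopy
open SimpleGraph

/-! ### Homotopy of cycles as equivalence and conjugacy of words. -/

section Walks

variable {V : Type*} {G : SimpleGraph V}

theorem head?_support {u v : V} (p : G.Walk u v) : p.support.head? = some u := by
  cases p <;> rfl

theorem getLast?_support {u v : V} (p : G.Walk u v) : p.support.getLast? = some v := by
  rw [List.getLast?_eq_getLast_of_ne_nil p.support_ne_nil, Walk.getLast_support]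

theorem exists_walk_support_eq {l : List V} (h : l.IsChain G.Adj) {u v : V}
    (hu : l.head? = some u) (hv : l.getLast? = some v) : ∃ p : G.Walk u v, p.support = l := by
  have hne : l ≠ [] := by rintro rfl; simp at hu
  have h1 : l.head hne = u := by rw [List.head?_eq_some_head hne] at hu; simpa using hu
  have h2 : l.getLast hne = v := by
    rw [List.getLast?_eq_getLast_of_ne_nil hne] at hv; simpa using hv
  subst h1 h2
  exact ⟨Walk.ofSupport l hne h, Walk.support_ofSupport hne h⟩

theorem ElementaryCancellation.cons {u v w : V} (h : G.Adj u v) {p q : G.Walk v w}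
    (hpq : ElementaryCancellation p q) :
    ElementaryCancellation (Walk.cons h p) (Walk.cons h q) := by
  obtain ⟨p, h', q⟩ := hpq
  exact .mk (Walk.cons h p) h' q

theorem eqvGen_cancellation_cons {u v w : V} (h : G.Adj u v) {p q : G.Walk v w}
    (hpq : Relation.EqvGen ElementaryCancellation p q) :
    Relation.EqvGen ElementaryCancellation (Walk.cons h p) (Walk.cons h q) := by
  induction hpq with
  | rel _ _ h' => exact .rel _ _ (h'.cons h)
  | refl => exact .refl _
  | symm _ _ _ ih => exact .symm _ _ ih
  | trans _ _ _ _ _ ih1 ih2 => exact .trans _ _ _ ih1 ih2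

/-- Adjacent vertices are distinct, so a walk has no repetitions; the only obstruction to being
reduced is a spike, and removing it is an elementary cancellation within the graph. -/
theorem exists_isReduced_walk {u v : V} (p : G.Walk u v) :
    ∃ q : G.Walk u v, Relation.EqvGen ElementaryCancellation p q ∧ IsReduced q.support := by
  induction p with
  | nil => exact ⟨.nil, .refl _, trivial⟩
  | @cons u v w h p ih =>
    obtain ⟨q, hpq, hq⟩ := ih
    have h1 := eqvGen_cancellation_cons h hpq
    cases q with
    | nil => exact ⟨_, h1, h.ne, by simp, trivial⟩
    | @cons _ x _ h' q =>
      by_cases hx : x = u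
      · subst hx
        exact ⟨q, h1.trans _ _ _ (.rel _ _ (.mk Walk.nil h q)), hq.tail⟩
      · refine ⟨_, h1, h.ne, ?_, hq⟩
        simpa [head?_support] using hx

variable [DecidableEq V]

theorem support_append_equiv {u v w : V} (p : G.Walk u v) (q : G.Walk v w) :
    WordEquiv (p.append q).support (p.support ++ q.support) := by
  have h := List.dropLast_append_getLast? _ (getLast?_support p)
  rw [Walk.support_append_eq_support_dropLast_append, ← h]
  have := equiv_junction p.support.dropLast q.support.tail v
  rw [List.dropLast_concat, ← Walk.cons_tail_support q]
  exact this.symm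

theorem ElementaryCancellation.equiv {u v : V} {p q : G.Walk u v}
    (h : ElementaryCancellation p q) : WordEquiv p.support q.support := by
  obtain ⟨p, h, q⟩ := h
  simp only [Walk.support_append_eq_support_dropLast_append, Walk.support_cons]
  apply WordEquiv.append_left
  rw [← Walk.cons_tail_support q]
  exact (equiv_spike _ _).append_right _

/-- Two walks are related by elementary cancellations if and only if their reduced forms agree. -/
theorem eqvGen_cancellation_iff {u v : V} {p q : G.Walk u v} :
    Relation.EqvGen ElementaryCancellation p q ↔ WordEquiv p.support q.support := by
  have key : ∀ {p q : G.Walk u v}, Relation.EqvGen ElementaryCancellation p q →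
      WordEquiv p.support q.support := by
    intro p q h
    induction h with
    | rel _ _ h => exact h.equiv
    | refl => exact .refl _
    | symm _ _ _ ih => exact ih.symm
    | trans _ _ _ _ _ ih1 ih2 => exact ih1.trans ih2
  refine ⟨key, fun h => ?_⟩
  obtain ⟨p', hp, hp'⟩ := exists_isReduced_walk p
  obtain ⟨q', hq, hq'⟩ := exists_isReduced_walk q
  have := ((key hp).symm.trans h).trans (key hq)
  rw [wordEquiv_iff_of_isReduced hp' hq'] at this
  obtain rfl := Walk.ext_support this
  exact hp.trans _ _ _ (hq.symm _ _)

theorem basedHomotopic_iff {v : V} {p q : G.Walk v v} :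
    BasedHomotopic p q ↔ WordEquiv p.support q.support := eqvGen_cancellation_iff

/-- Closed walks are conjugate if conjugation with some walk between the basepoints takes one to the
other, up to reduction. -/
def WalkConj (c d : Σ v : V, G.Walk v v) : Prop :=
  ∃ r : G.Walk c.1 d.1, WordEquiv (c.2.support ++ r.support) (r.support ++ d.2.support)

theorem equiv_support_append_nil {u v : V} (p : G.Walk u v) :
    WordEquiv (p.support ++ [v]) p.support := equiv_concat_of_getLast? (getLast?_support p)

theorem equiv_cons_support {u v : V} (p : G.Walk u v) :
    WordEquiv ([u] ++ p.support) p.support := equiv_cons_of_head? (head?_support p)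

theorem equiv_support_append_reverse {u v : V} (p : G.Walk u v) :
    WordEquiv (p.support ++ p.support.reverse) [u] := equiv_append_reverse (head?_support p)

theorem walkConj_iff {c d : Σ v : V, G.Walk v v} :
    WalkConj c d ↔ ∃ r : G.Walk c.1 d.1,
      WordEquiv (r.support.reverse ++ c.2.support ++ r.support) d.2.support :=
  exists_congr fun r => (conj_equiv_iff (head?_support r) (getLast?_support r)
    (head?_support _) (head?_support _)).symm

theorem WalkConj.refl (c : Σ v : V, G.Walk v v) : WalkConj c c :=
  ⟨.nil, (equiv_support_append_nil c.2).trans (equiv_cons_support c.2).symm⟩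

theorem WalkConj.symm {c d : Σ v : V, G.Walk v v} (h : WalkConj c d) : WalkConj d c := by
  obtain ⟨r, hr⟩ := h
  rw [walkConj_iff]
  refine ⟨r.reverse, ?_⟩
  rw [Walk.support_reverse, List.reverse_reverse]
  calc WordEquiv (r.support ++ d.2.support ++ r.support.reverse)
        (c.2.support ++ r.support ++ r.support.reverse) := hr.symm.append_right _
    WordEquiv _ (c.2.support ++ [c.1]) := by
      rw [List.append_assoc]; exact (equiv_support_append_reverse r).append_left _
    WordEquiv _ c.2.support := equiv_support_append_nil _

theorem WalkConj.trans {c d e : Σ v : V, G.Walk v v} (h : WalkConj c d) (h' : WalkConj d e) :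
    WalkConj c e := by
  obtain ⟨r, hr⟩ := h
  obtain ⟨s, hs⟩ := h'
  refine ⟨r.append s, ?_⟩
  have hrs := support_append_equiv r s
  calc WordEquiv (c.2.support ++ (r.append s).support) (c.2.support ++ (r.support ++ s.support)) :=
        hrs.append_left _
    WordEquiv _ (r.support ++ (d.2.support ++ s.support)) := by
      simpa using hr.append_right s.support
    WordEquiv _ (r.support ++ (s.support ++ e.2.support)) := hs.append_left _
    WordEquiv _ ((r.append s).support ++ e.2.support) := by
      simpa using (hrs.append_right e.2.support).symm

theorem CyclicShift.walkConj {c d : Σ v : V, G.Walk v v} (h : CyclicShift c d) :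
    WalkConj c d := by
  obtain ⟨p, q⟩ := h
  refine ⟨p, ?_⟩
  calc WordEquiv ((p.append q).support ++ p.support) (p.support ++ q.support ++ p.support) :=
        (support_append_equiv p q).append_right _
    WordEquiv _ (p.support ++ (q.append p).support) := by
      simpa using (support_append_equiv q p).symm.append_left p.support

/-- Oriented cycles are freely homotopic if and only if representing walks are conjugate. -/
theorem orientedCycle_homotopic_iff {u v : V} {p : G.Walk u u} {q : G.Walk v v} :
    (OrientedCycle.mk p).Homotopic (OrientedCycle.mk q) ↔ WalkConj ⟨u, p⟩ ⟨v, q⟩ := by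
  have lift_eq : ∀ c d : Σ v : V, G.Walk v v,
      (Quot.mk CyclicShift c = Quot.mk CyclicShift d) → WalkConj c d := by
    intro c d h
    rw [Quot.eq] at h
    induction h with
    | rel _ _ h => exact h.walkConj
    | refl => exact .refl _
    | symm _ _ _ ih => exact ih.symm
    | trans _ _ _ _ _ ih1 ih2 => exact ih1.trans ih2
  have of_cancel : ∀ {w : V} {p q : G.Walk w w}, WordEquiv p.support q.support →
      WalkConj ⟨w, p⟩ ⟨w, q⟩ := fun {w p q} h =>
    ⟨.nil, (equiv_support_append_nil p).trans (h.trans (equiv_cons_support q).symm)⟩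
  constructor
  · intro h
    -- Representatives are quantified inside the induction because successive cancellations may use
    -- different basepoints of the same oriented cycle.
    have key : ∀ c d : OrientedCycle G, c.Homotopic d → ∀ c' d' : Σ v : V, G.Walk v v,
        c = Quot.mk _ c' → d = Quot.mk _ d' → WalkConj c' d' := by
      intro c d h
      induction h with
      | rel _ _ h =>
        obtain ⟨w, p, q, rfl, rfl, h⟩ := h
        intro c' d' hc hd
        exact (lift_eq _ _ hc.symm).trans ((of_cancel h.equiv).trans (lift_eq _ _ hd))
      | refl => intro c' d' hc hd; exact lift_eq _ _ (hc.symm.trans hd)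
      | symm _ _ _ ih => intro c' d' hc hd; exact (ih d' c' hd hc).symm
      | trans _ y _ _ _ ih1 ih2 =>
        intro c' d' hc hd
        obtain ⟨y', rfl⟩ := Quot.exists_rep y
        exact (ih1 _ _ hc rfl).trans (ih2 _ _ rfl hd)
    exact key _ _ h _ _ rfl rfl
  · intro h
    have based : ∀ {w : V} {p q : G.Walk w w}, WordEquiv p.support q.support →
        (OrientedCycle.mk p).Homotopic (OrientedCycle.mk q) := by
      intro w p q h
      induction eqvGen_cancellation_iff.2 h with
      | rel p q hc => exact .rel _ _ ⟨w, p, q, rfl, rfl, hc⟩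
      | refl => exact .refl _
      | symm _ _ h' ih => exact .symm _ _ (ih (eqvGen_cancellation_iff.1 h'))
      | trans _ _ _ h1 h2 ih1 ih2 =>
        exact .trans _ _ _ (ih1 (eqvGen_cancellation_iff.1 h1)) (ih2 (eqvGen_cancellation_iff.1 h2))
    obtain ⟨r, hr⟩ := walkConj_iff.1 h
    -- Conjugation is a based homotopy inserting `r r⁻¹`, followed by a cyclic shift and a based
    -- homotopy to `q`.
    have e1 : (OrientedCycle.mk p).Homotopic (OrientedCycle.mk (p.append (r.append r.reverse))) := by
      apply based
      refine ((support_append_equiv _ _).trans (WordEquiv.trans ?_ (equiv_support_append_nil p))).symm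
      apply WordEquiv.append_left
      exact (support_append_equiv r r.reverse).trans
        (by rw [Walk.support_reverse]; exact equiv_support_append_reverse r)
    have e2 : OrientedCycle.mk (p.append (r.append r.reverse)) =
        OrientedCycle.mk (r.reverse.append (p.append r)) := by
      rw [Walk.append_assoc]
      exact Quot.sound (.mk _ _)
    rw [e2] at e1
    refine e1.trans _ _ _ (based ?_)
    refine (support_append_equiv _ _).trans ?_
    refine ((support_append_equiv _ _).append_left _).trans ?_
    simpa [Walk.support_reverse] using hr

end Walks

/-! ### Walks that are allowed to stall. -/

section LazyChains

variable {V : Type*} [DecidableEq V] {R : V → V → Prop}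

theorem isChain_push {a : V} {s : List V} (hs : s.IsChain R)
    (h : ∀ b ∈ s.head?, a = b ∨ R a b) : (push a s).IsChain R := by
  match s with
  | [] => simp [push]
  | b :: t =>
    rw [push]
    split_ifs with h1 h2
    · exact hs
    · exact hs.tail
    · have := h b rfl
      simp_all

/-- The reduced form of a lazy walk is a walk. -/
theorem isChain_reduce {l : List V} (h : l.IsChain fun a b => a = b ∨ R a b) :
    (reduce l).IsChain R := by
  induction l with
  | nil => exact .nil
  | cons a l ih =>
    refine isChain_push (ih h.tail) fun b hb => ?_
    rw [← reduce, head?_reduce] at hb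
    exact h.rel_head? hb

end LazyChains

end GraphHomotopy

namespace GraphHomotopy

/-! ### A length bound for shortest simultaneous conjugators. -/

section ConjugatorBound

variable {V : Type*}

theorem isReduced_concat {t : List V} {x c d : V} (h : IsReduced (t ++ [x, c])) (hc : d ≠ c)
    (hx : d ≠ x) : IsReduced (t ++ [x, c, d]) := by
  induction t with
  | nil => simp_all [IsReduced, eq_comm]
  | cons y t ih =>
    have := ih h.tail
    match t with
    | [] => simp_all [IsReduced]
    | [z] => simp_all [IsReduced]
    | z :: w :: t => simp_all [IsReduced]

/-- Once conjugation by `c` has lengthened the word at both ends, the next letter `d` of a reduced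
conjugator differs from `c` and `x`, so it cannot cancel at either end, and the situation repeats
itself. -/
theorem isReduced_conj {x c : V} {γ s t t' : List V} (hs : IsReduced s) (ht : s = c :: x :: t)
    (ht' : s = t' ++ [x, c]) (hγ : IsReduced (x :: c :: γ)) :
    IsReduced (γ.reverse ++ s ++ γ) := by
  induction γ generalizing s x c t t' with
  | nil => simpa using hs
  | cons d γ ih =>
    have hdc : d ≠ c := hγ.2.2.1.symm
    have hdx : d ≠ x := by simpa using hγ.2.1
    have h1 : IsReduced (d :: s) := by
      subst ht; exact ⟨hdc, by simpa using hdx.symm, hs⟩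
    have h2 : IsReduced (d :: s ++ [d]) := by
      rw [ht'] at h1 ⊢
      simpa using isReduced_concat (t := d :: t') (by simpa using h1) hdc hdx
    have := ih (s := d :: s ++ [d]) (t := x :: t ++ [d]) (t' := d :: (t' ++ [x])) h2
      (by simp [ht]) (by simp [ht']) hγ.2.2
    simpa using this

variable [DecidableEq V]

/-- Cancellation happens unless `c` differs from the basepoint and from the second and the
penultimate letter; a single cancellation already pays for the added letters. -/
theorem length_conj_le_or {r : List V} {x : V} (hr : IsReduced r) (hx : r.head? = some x)
    (hx' : r.getLast? = some x) (c : V) :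
    (reduce (c :: r ++ [c])).length ≤ r.length ∨ IsReduced (c :: r ++ [c]) := by
  obtain ⟨s, rfl⟩ : ∃ s, r = x :: s := by
    cases r with
    | nil => simp at hx
    | cons b t => exact ⟨t, by simp_all⟩
  cases s with
  | nil =>
    left
    have : reduce (c :: [x] ++ [c]) = reduce [c] := equiv_spike c x
    rw [this]
    exact length_reduce_le [c]
  | cons y t =>
    by_cases hcx : c = x
    · subst hcx
      left
      have : reduce (c :: (c :: y :: t) ++ [c]) = reduce (c :: y :: t) :=
        (equiv_concat_of_getLast? (by simpa using hx')).trans (equiv_cons_of_head? rfl)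
      rw [this]
      exact length_reduce_le _
    by_cases hcy : c = y
    · subst hcy
      left
      have : reduce (c :: (x :: c :: t) ++ [c]) = reduce (c :: t ++ [c]) :=
        (equiv_spike c x).append_right (t ++ [c])
      rw [this]
      exact (length_reduce_le _).trans (by simp)
    obtain ⟨t', z, ht⟩ : ∃ t' z, x :: y :: t = t' ++ [z, x] := by
      have h1 := List.dropLast_append_getLast? x hx'
      have h2 : (x :: y :: t).dropLast ≠ [] := by simp
      refine ⟨(x :: y :: t).dropLast.dropLast, (x :: y :: t).dropLast.getLast h2, ?_⟩
      conv_lhs => rw [← h1, ← List.dropLast_append_getLast h2]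
      simp
    have h1 : IsReduced (c :: x :: y :: t) := ⟨hcx, by simpa using Ne.symm hcy, hr⟩
    rw [ht] at h1 ⊢
    by_cases hcz : c = z
    · subst hcz
      left
      have : reduce (c :: (t' ++ [c, x]) ++ [c]) = reduce (c :: (t' ++ [c])) := by
        simpa [WordEquiv] using (equiv_spike c x).append_left (c :: t')
      rw [this]
      exact (length_reduce_le _).trans (by simp)
    · right
      simpa using isReduced_concat (t := c :: t') (by simpa using h1) hcx hcz

/-- The length of the conjugates of a closed walk is quasiconvex along a reduced walk. -/
theorem length_conj_le_max {γ : List V} {r : List V} {x : V} (hr : IsReduced r)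
    (hx : r.head? = some x) (hx' : r.getLast? = some x) (hγ : IsReduced (x :: γ)) (k : ℕ) :
    (reduce ((γ.take k).reverse ++ r ++ γ.take k)).length ≤
      max r.length (reduce (γ.reverse ++ r ++ γ)).length := by
  induction γ generalizing r x k with
  | nil => simp [length_reduce_le]
  | cons c γ ih =>
    cases k with
    | zero => simp [length_reduce_le]
    | succ k =>
      have key : ∀ δ : List V, reduce ((c :: δ).reverse ++ r ++ c :: δ) =
          reduce (δ.reverse ++ reduce (c :: r ++ [c]) ++ δ) := by
        intro δ
        have := (((equiv_reduce (c :: r ++ [c])).append_left δ.reverse).append_right δ).symm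
        simpa [WordEquiv] using this
      rw [List.take_succ_cons, key, key]
      rcases length_conj_le_or hr hx hx' c with h | h
      · refine (ih (isReduced_reduce _) ?_ ?_ hγ.tail k).trans (max_le_max h le_rfl)
        · rw [head?_reduce]; rfl
        · rw [getLast?_reduce, List.getLast?_append]; simp
      · obtain ⟨t, rfl⟩ : ∃ s, r = x :: s := by
          cases r with
          | nil => simp at hx
          | cons b t => exact ⟨t, by simp_all⟩
        have ht := (List.dropLast_append_getLast? x hx').symm
        have h3 : IsReduced (γ.reverse ++ (c :: (x :: t) ++ [c]) ++ γ) :=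
          isReduced_conj (t := t ++ [c]) (t' := c :: (x :: t).dropLast) h rfl
            (by conv_lhs => rw [ht]
                simp) hγ
        rw [h.reduce_eq, h3.reduce_eq]
        refine (length_reduce_le _).trans (le_max_of_le_right ?_)
        simp only [List.length_append, List.length_reverse, List.length_take]
        omega

/-- `γ` is a walk from `u` to `v` which conjugates each `a i` to `b i`. -/
structure IsConjugator {ι : Type*} (R : V → V → Prop) (u v : V) (a b : ι → List V)
    (γ : List V) : Prop where
  isChain : γ.IsChain R
  head : γ.head? = some u
  last : γ.getLast? = some v
  conj : ∀ i, WordEquiv (γ.reverse ++ a i ++ γ) (b i)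

/-- A conjugator can be shortened if two of its prefixes conjugate in the same way. -/
theorem IsConjugator.cut {ι : Type*} [Nonempty ι] {R : V → V → Prop}
    {u v : V} {a b : ι → List V} {δ : List V} (hδ : IsConjugator R u v a b δ) {k l : ℕ}
    (hkl : k < l) (hl : l < δ.length)
    (hT : ∀ i, WordEquiv ((δ.take (k + 1)).reverse ++ a i ++ δ.take (k + 1))
      ((δ.take (l + 1)).reverse ++ a i ++ δ.take (l + 1))) :
    IsConjugator R u v a b (δ.take (k + 1) ++ δ.drop (l + 1)) := by
  have hk : k < δ.length := hkl.trans hl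
  have hne : δ ≠ [] := List.ne_nil_of_length_pos (by omega)
  have htk : ∀ (j : ℕ) (hj : j < δ.length), (δ.take (j + 1)).getLast? = some δ[j] := by
    intro j hj
    rw [List.getLast?_take]; simp [hj]
  have hhead : ∀ i (j : ℕ) (hj : j < δ.length),
      ((δ.take (j + 1)).reverse ++ a i ++ δ.take (j + 1)).head? = some δ[j] := by
    intro i j hj
    rw [List.append_assoc, List.head?_append_of_ne_nil, List.head?_reverse, htk j hj]
    simpa using hne
  obtain ⟨i₀⟩ := ‹Nonempty ι›
  -- A conjugate begins at the endpoint of the prefix that produced it, so equal conjugates force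
  -- the two cut ends to coincide.
  have hkl' : δ[k] = δ[l] := by
    have := (hT i₀).head?_eq
    rw [hhead i₀ k hk, hhead i₀ l hl] at this
    exact Option.some.inj this
  have hdrop : δ.drop l = δ[l] :: δ.drop (l + 1) := List.drop_eq_getElem_cons hl
  refine ⟨?_, ?_, ?_, fun i => ?_⟩
  · rw [List.isChain_append]
    refine ⟨hδ.isChain.take _, hδ.isChain.drop _, ?_⟩
    intro x hx y hy
    rw [htk k hk] at hx
    have h4 := hδ.isChain.drop l
    rw [hdrop] at h4
    obtain rfl : δ[k] = x := by simpa using hx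
    rw [hkl']
    exact h4.rel_head? hy
  · rw [List.head?_append_of_ne_nil]
    · rw [List.head?_take]; simp [hδ.head]
    · simpa using hne
  · by_cases hl' : l + 1 < δ.length
    · rw [List.getLast?_append_of_ne_nil, List.getLast?_drop]
      · simp [hδ.last, hl']
      · simpa using hl'
    · have h5 : l + 1 = δ.length := by omega
      rw [h5, List.drop_length, List.append_nil, htk k hk, hkl', ← hδ.last,
        List.getLast?_eq_getElem?]
      simp [← h5]
  · refine WordEquiv.trans ?_ (hδ.conj i)
    have h7 := ((hT i).append_left (δ.drop (l + 1)).reverse).append_right (δ.drop (l + 1))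
    have h8 : δ.reverse = (δ.drop (l + 1)).reverse ++ (δ.take (l + 1)).reverse := by
      rw [← List.reverse_append, List.take_append_drop]
    rw [h8]
    have h9 : WordEquiv ((δ.drop (l + 1)).reverse ++ (δ.take (l + 1)).reverse ++ a i ++
        (δ.take (l + 1) ++ δ.drop (l + 1))) ((δ.drop (l + 1)).reverse ++
          (δ.take (l + 1)).reverse ++ a i ++ δ) := by
      rw [List.take_append_drop]; exact .refl _
    refine WordEquiv.trans ?_ h9
    simpa using h7

/-- If a nonempty finite family of closed walks of bounded length can be conjugated to another one,
then this can be done by a walk whose length is bounded in terms of the number of words. -/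
theorem IsConjugator.exists_length_le {ι : Type*} [Fintype ι] [Nonempty ι] {R : V → V → Prop}
    {u v : V} {a b : ι → List V} {γ : List V} (hγ : IsConjugator R u v a b γ) {C : ℕ}
    {S : Finset (List V)} (hS : ∀ l : List V, l.length ≤ C → l ∈ S)
    (ha : ∀ i, (a i).head? = some u) (ha' : ∀ i, (a i).getLast? = some u)
    (haC : ∀ i, (a i).length ≤ C) (hbC : ∀ i, (b i).length ≤ C) :
    ∃ γ, IsConjugator R u v a b γ ∧ γ.length ≤ S.card ^ Fintype.card ι := by
  classical
  have hex : ∃ n γ, IsConjugator R u v a b γ ∧ γ.length = n := ⟨_, γ, hγ, rfl⟩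
  obtain ⟨γ₀, h₀, hlen₀⟩ := Nat.find_spec hex
  have hmin : ∀ δ, IsConjugator R u v a b δ → γ₀.length ≤ δ.length := fun δ hδ =>
    hlen₀ ▸ Nat.find_min' hex ⟨δ, hδ, rfl⟩
  have h₁ : IsConjugator R u v a b (reduce γ₀) := by
    refine ⟨isChain_reduce (h₀.isChain.imp fun _ _ => Or.inr), ?_, ?_, fun i => ?_⟩
    · rw [head?_reduce, h₀.head]
    · rw [getLast?_reduce, h₀.last]
    · refine WordEquiv.trans ?_ (h₀.conj i)
      have e := (equiv_reduce γ₀).append_left ((reduce γ₀).reverse ++ a i)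
      refine e.trans (((WordEquiv.append_right ?_ (a i))).append_right γ₀)
      have h1 := equiv_reverse_append (p := reduce γ₀) (a := v) (by rw [getLast?_reduce, h₀.last])
      have h2 := equiv_append_reverse (p := γ₀) h₀.head
      calc WordEquiv (reduce γ₀).reverse ((reduce γ₀).reverse ++ [u]) :=
            (equiv_concat_of_getLast? (by rw [List.getLast?_reverse, head?_reduce, h₀.head])).symm
        WordEquiv _ ((reduce γ₀).reverse ++ (γ₀ ++ γ₀.reverse)) := h2.symm.append_left _
        WordEquiv _ ((reduce γ₀).reverse ++ (reduce γ₀ ++ γ₀.reverse)) :=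
            ((equiv_reduce γ₀).symm.append_right _).append_left _
        WordEquiv _ ([v] ++ γ₀.reverse) := by simpa using h1.append_right γ₀.reverse
        WordEquiv _ γ₀.reverse := equiv_cons_of_head? (p := γ₀.reverse) (by rw [List.head?_reverse, h₀.last])
  have hmin' : ∀ δ, IsConjugator R u v a b δ → (reduce γ₀).length ≤ δ.length := fun δ hδ =>
    (length_reduce_le γ₀).trans (hmin δ hδ)
  have hred := isReduced_reduce γ₀
  generalize reduce γ₀ = δ at h₁ hmin' hred
  refine ⟨δ, h₁, ?_⟩
  -- Pigeonhole: `T k` is the tuple of conjugates by the prefix ending at position `k`. It takes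
  -- values in `S ^ ι`, and minimality of `δ` makes `T` injective.
  let T : ℕ → ι → List V := fun k i => reduce ((δ.take (k + 1)).reverse ++ a i ++ δ.take (k + 1))
  have hhead : δ.head? = some u := h₁.head
  obtain ⟨δ', rfl⟩ : ∃ s, δ = u :: s := by
    cases hδ : δ with
    | nil => simp [hδ] at hhead
    | cons b t => exact ⟨t, by simp_all⟩
  -- The initial letter `u` is absorbed, since each `a i` already begins and ends there.
  have hconj : ∀ (i : ι) (p : List V), WordEquiv ((u :: p).reverse ++ a i ++ u :: p)
      (p.reverse ++ reduce (a i) ++ p) := by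
    intro i p
    have e1 : WordEquiv ([u] ++ a i ++ [u]) (reduce (a i)) :=
      (equiv_concat_of_getLast? (by simp [List.getLast?_cons, ha' i])).trans
        ((equiv_cons_of_head? (ha i)).trans (equiv_reduce _).symm)
    have := (e1.append_left p.reverse).append_right p
    simpa using this
  have hTlen : ∀ k i, (T k i).length ≤ C := by
    intro k i
    have h2 : T k i = reduce ((δ'.take k).reverse ++ reduce (a i) ++ δ'.take k) := hconj i _
    rw [h2]
    refine (length_conj_le_max (x := u) (isReduced_reduce _) ?_ ?_ hred k).trans
      (max_le ((length_reduce_le _).trans (haC i)) ?_)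
    · rw [head?_reduce, ha i]
    · rw [getLast?_reduce, ha' i]
    · have h3 : reduce (δ'.reverse ++ reduce (a i) ++ δ') = reduce (b i) :=
        (hconj i δ').symm.trans (h₁.conj i)
      rw [h3]
      exact (length_reduce_le _).trans (hbC i)
  have hinj : Set.InjOn T (Finset.range (u :: δ').length) := by
    suffices H : ∀ k l, k < l → l < (u :: δ').length → T k ≠ T l by
      intro k hk l hl hkl
      by_contra hne
      rcases Nat.lt_or_gt_of_ne hne with h | h
      · exact H k l h (by simpa using hl) hkl
      · exact H l k h (by simpa using hk) hkl.symm
    intro k l hkl hl hT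
    have hnew := h₁.cut hkl hl fun i => congrFun hT i
    have := hmin' _ hnew
    simp only [List.length_append, List.length_take, List.length_drop] at this
    omega
  have hmaps : Set.MapsTo T (Finset.range (u :: δ').length)
      (Fintype.piFinset fun _ : ι => S) := by
    intro k _
    simp only [Finset.mem_coe, Fintype.mem_piFinset]
    exact fun i => hS _ (hTlen k i)
  have := Finset.card_le_card_of_injOn T hmaps hinj
  simpa using this

end ConjugatorBound

end GraphHomotopy

namespace GraphHomotopy
open SimpleGraph unitInterval

/-! ### Moving words across a grid of labels. -/

section Grid

variable {V : Type*} [DecidableEq V]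

theorem equiv_middle {p q s : V} (h : p = q ∨ q = s ∨ p = s) : WordEquiv [p, q, s] [p, s] := by
  rcases h with rfl | rfl | rfl
  · exact (equiv_repeat p).append_right [s]
  · exact (equiv_repeat q).cons p
  · exact (equiv_spike p q).trans (equiv_repeat p).symm

/-- An edge is simply connected: a word that stays on it is determined by its ends. -/
theorem equiv_pair_of_two_letters {x y : V} {l : List V} (hl : ∀ z ∈ l, z = x ∨ z = y) {a b : V}
    (ha : l.head? = some a) (hb : l.getLast? = some b) : WordEquiv l [a, b] := by
  induction l generalizing a with
  | nil => simp at ha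
  | cons c l ih =>
    obtain rfl : c = a := by simpa using ha
    cases l with
    | nil =>
      obtain rfl : c = b := by simpa using hb
      exact (equiv_repeat c).symm
    | cons d l =>
      have h1 := ih (fun z hz => hl z (by simp_all)) rfl (by simpa using hb)
      refine (h1.cons c).trans (equiv_middle ?_)
      have hc := hl c (by simp)
      have hd := hl d (by simp)
      have hb' := hl b (List.mem_of_getLast? hb)
      grind

/-- The words along the two sides of a grid are equivalent if there are at most two letters around
each of its small squares. -/
theorem grid_equiv (a : ℕ → ℕ → V) (N : ℕ)
    (h : ∀ i < N, ∀ j < N, WordEquiv [a i j, a i (j + 1), a (i + 1) (j + 1)]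
      [a i j, a (i + 1) j, a (i + 1) (j + 1)]) :
    WordEquiv ((List.range (N + 1)).map (fun j => a 0 j) ++ (List.range (N + 1)).map fun i => a i N)
      ((List.range (N + 1)).map (fun i => a i 0) ++ (List.range (N + 1)).map fun j => a N j) := by
  have hlast : ∀ (b : ℕ → V) M, WordEquiv ((List.range (M + 1)).map b ++ [b M])
      ((List.range (M + 1)).map b) := fun b M =>
    equiv_concat_of_getLast? (by simp [List.range_succ])
  -- Row `i` is carried to row `i + 1` one small square at a time; `key` then stacks the rows.
  have strip : ∀ i < N, ∀ M ≤ N, WordEquiv ((List.range (M + 1)).map (a i) ++ [a (i + 1) M])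
      (a i 0 :: (List.range (M + 1)).map (a (i + 1))) := by
    intro i hi M hM
    induction M with
    | zero => exact .refl _
    | succ M ih =>
      calc WordEquiv ((List.range (M + 1 + 1)).map (a i) ++ [a (i + 1) (M + 1)])
            ((List.range (M + 1)).map (a i) ++ [a i M] ++ [a i (M + 1), a (i + 1) (M + 1)]) := by
            rw [List.range_succ (n := M + 1), List.map_append, List.append_assoc]
            exact (hlast (a i) M).symm.append_right _
        WordEquiv _ ((List.range (M + 1)).map (a i) ++ [a i M] ++
            [a (i + 1) M, a (i + 1) (M + 1)]) := by
            simpa using (h i hi M (by omega)).append_left ((List.range (M + 1)).map (a i))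
        WordEquiv _ ((List.range (M + 1)).map (a i) ++ [a (i + 1) M, a (i + 1) (M + 1)]) :=
            (hlast (a i) M).append_right _
        WordEquiv _ (a i 0 :: (List.range (M + 1)).map (a (i + 1)) ++ [a (i + 1) (M + 1)]) := by
            simpa using (ih (by omega)).append_right [a (i + 1) (M + 1)]
        WordEquiv _ (a i 0 :: (List.range (M + 1 + 1)).map (a (i + 1))) := by
            rw [List.range_succ (n := M + 1), List.map_append]
            exact .refl _
  have key : ∀ K ≤ N, WordEquiv ((List.range (N + 1)).map (a 0) ++
      (List.range (K + 1)).map fun i => a i N)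
      ((List.range (K + 1)).map (fun i => a i 0) ++ (List.range (N + 1)).map (a K)) := by
    intro K hK
    induction K with
    | zero =>
      refine (hlast (a 0) N).trans (equiv_cons_of_head? ?_).symm
      simp [List.range_succ_eq_map]
    | succ K ih =>
      have hN : WordEquiv (a (K + 1) 0 :: (List.range (N + 1)).map (a (K + 1)))
          ((List.range (N + 1)).map (a (K + 1))) :=
        equiv_cons_of_head? (by simp [List.range_succ_eq_map])
      rw [List.range_succ (n := K + 1)]
      calc WordEquiv ((List.range (N + 1)).map (a 0) ++
            (List.range (K + 1) ++ [K + 1]).map fun i => a i N)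
            ((List.range (K + 1)).map (fun i => a i 0) ++ ((List.range (N + 1)).map (a K) ++
              [a (K + 1) N])) := by
            simpa using (ih (by omega)).append_right [a (K + 1) N]
        WordEquiv _ ((List.range (K + 1)).map (fun i => a i 0) ++ [a K 0] ++
            (List.range (N + 1)).map (a (K + 1))) := by
            simpa using (strip K (by omega) N le_rfl).append_left
              ((List.range (K + 1)).map (fun i => a i 0))
        WordEquiv _ ((List.range (K + 1)).map (fun i => a i 0) ++
            (List.range (N + 1)).map (a (K + 1))) := (hlast (fun i => a i 0) K).append_right _
        WordEquiv _ ((List.range (K + 1) ++ [K + 1]).map (fun i => a i 0) ++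
            (List.range (N + 1)).map (a (K + 1))) := by
            simpa using (hN.symm.append_left ((List.range (K + 1)).map (fun i => a i 0)))
  exact key N le_rfl

end Grid

/-! ### From a topological homotopy to words, by sampling. -/

section Realization

variable {V W : Type*} [Fintype V] [Fintype W] [DecidableEq V] [DecidableEq W]
  {G : SimpleGraph V} {H : SimpleGraph W}

/-- The point which divides the (possibly degenerate) edge `a, b` in the ratio `s : 1 - s`. -/
noncomputable def edgePoint {a b : V} (h : a = b ∨ G.Adj a b) (s : I) : realization G :=
  ⟨⟨fun v => (1 - s) * (if v = a then 1 else 0) + s * (if v = b then 1 else 0), by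
    refine ⟨fun v => ?_, ?_⟩
    · have h1 := s.2.1
      have h2 : 0 ≤ 1 - (s : ℝ) := sub_nonneg.2 s.2.2
      positivity
    · simp [Finset.sum_add_distrib]⟩, a, b, h, fun v hv => by
    by_contra hc
    rw [not_or] at hc
    exact hv (by change (1 - (s : ℝ)) * (if v = a then 1 else 0) + s * (if v = b then 1 else 0) = 0
                 simp [hc.1, hc.2])⟩

theorem edgePoint_apply {a b : V} (h : a = b ∨ G.Adj a b) (s : I) (v : V) :
    (edgePoint h s).1 v = (1 - s) * (if v = a then 1 else 0) + s * (if v = b then 1 else 0) := rfl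

omit [DecidableEq V] in
theorem realization_ext {x y : realization G} (h : ∀ v, x.1 v = y.1 v) : x = y :=
  Subtype.ext (Subtype.ext (funext h))

variable (G) in
/-- A vertex of a graph as a point of the realization. -/
noncomputable def vertexPoint (v : V) : realization G := edgePoint (.inl (Eq.refl v)) 0

theorem vertexPoint_apply (a v : V) : (vertexPoint G a).1 v = if v = a then 1 else 0 := by
  simp [vertexPoint, edgePoint_apply]

theorem edgePoint_zero {a b : V} (h : a = b ∨ G.Adj a b) : edgePoint h 0 = vertexPoint G a :=
  realization_ext fun v => by simp [vertexPoint_apply, edgePoint_apply]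

theorem edgePoint_one {a b : V} (h : a = b ∨ G.Adj a b) : edgePoint h 1 = vertexPoint G b :=
  realization_ext fun v => by simp [vertexPoint_apply, edgePoint_apply]

theorem edgePoint_self {a : V} (h : a = a ∨ G.Adj a a) (s : I) :
    edgePoint h s = vertexPoint G a :=
  realization_ext fun v => by simp only [vertexPoint_apply, edgePoint_apply]; ring

theorem edgePoint_symm {a b : V} (h : a = b ∨ G.Adj a b) (h' : b = a ∨ G.Adj b a) (s : I) :
    edgePoint h (σ s) = edgePoint h' s :=
  realization_ext fun v => by simp only [edgePoint_apply, unitInterval.coe_symm_eq]; ring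

omit [Fintype V] [Fintype W] [DecidableEq V] [DecidableEq W] in
theorem SimplicialMap.map_eq_or_adj (f : SimplicialMap G H) {a b : V} (h : a = b ∨ G.Adj a b) :
    f.toFun a = f.toFun b ∨ H.Adj (f.toFun a) (f.toFun b) :=
  h.elim (fun h => .inl (congrArg _ h)) (f.map_adj a b)

theorem realize_edgePoint (f : SimplicialMap G H) {a b : V} (h : a = b ∨ G.Adj a b) (s : I) :
    f.realize (edgePoint h s) = edgePoint (f.map_eq_or_adj h) s := by
  refine realization_ext fun w => ?_
  have : (f.realize (edgePoint h s)).1 w = (stdSimplex.map f.toFun (edgePoint h s).1) w := rfl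
  rw [this, stdSimplex.map_coe, FunOnFinite.linearMap_apply_apply, edgePoint_apply]
  have h2 : ∀ v, (edgePoint h s).1 v =
    (1 - s) * (if v = a then 1 else 0) + s * (if v = b then 1 else 0) := fun _ => rfl
  simp only [h2, Finset.sum_add_distrib, ← Finset.mul_sum, Finset.sum_ite_eq', Finset.mem_filter,
    Finset.mem_univ, true_and, eq_comm (a := w)]

theorem realize_vertexPoint (f : SimplicialMap G H) (v : V) :
    f.realize (vertexPoint G v) = vertexPoint H (f.toFun v) := realize_edgePoint f _ 0

omit [DecidableEq V] in
theorem abs_sub_le_dist (x y : realization G) (v : V) : |x.1 v - y.1 v| ≤ dist x y :=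
  dist_le_pi_dist x.1.1 y.1.1 v

theorem dist_edgePoint_le {a b : V} (h : a = b ∨ G.Adj a b) (s t : I) :
    dist (edgePoint h s) (edgePoint h t) ≤ dist s t := by
  change dist (edgePoint h s).1.1 (edgePoint h t).1.1 ≤ |(s : ℝ) - t|
  rw [dist_pi_le_iff (abs_nonneg _)]
  intro v
  change |(edgePoint h s).1 v - (edgePoint h t).1 v| ≤ _
  rw [edgePoint_apply, edgePoint_apply]
  split_ifs
  · simp
  · rw [abs_sub_comm]; apply le_of_eq; congr 1; ring
  · apply le_of_eq; congr 1; ring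
  · simp

omit [DecidableEq V] in
theorem eq_or_adj_of_ne_zero (x : realization G) {u v : V} (hu : x.1 u ≠ 0) (hv : x.1 v ≠ 0) :
    u = v ∨ G.Adj u v := by
  obtain ⟨a, b, hab, h⟩ := x.2
  rcases h u hu with rfl | rfl <;> rcases h v hv with rfl | rfl
  · exact .inl rfl
  · exact hab
  · exact hab.imp Eq.symm SimpleGraph.Adj.symm
  · exact .inl rfl

omit [DecidableEq V] in
theorem eq_of_three_ne_zero (x : realization G) {u v w : V} (hu : x.1 u ≠ 0) (hv : x.1 v ≠ 0)
    (hw : x.1 w ≠ 0) : u = v ∨ v = w ∨ u = w := by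
  obtain ⟨a, b, hab, h⟩ := x.2
  have := h u hu
  have := h v hv
  have := h w hw
  grind

theorem exists_half_le (x : realization G) : ∃ v, 1 / 2 ≤ x.1 v := by
  obtain ⟨a, b, hab, h⟩ := x.2
  by_contra! hc
  have hsum : ∑ v, x.1 v = 1 := stdSimplex.sum_eq_one x.1
  have hsub : ∑ v ∈ {a, b}, x.1 v = ∑ v, x.1 v := by
    refine Finset.sum_subset (Finset.subset_univ _) fun v _ hv => ?_
    by_contra h0
    exact hv (by simpa using h v h0)
  have := hc a
  have := hc b
  by_cases hab : a = b
  · subst hab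
    simp only [Finset.mem_singleton, Finset.insert_eq_of_mem, Finset.sum_singleton] at hsub
    linarith
  · rw [Finset.sum_pair hab] at hsub
    linarith

/-- A vertex at which a point of the realization has a coordinate that is at least `1 / 2`. -/
noncomputable def label (x : realization G) : V := (exists_half_le x).choose

theorem half_le_label (x : realization G) : 1 / 2 ≤ x.1 (label x) := (exists_half_le x).choose_spec

theorem label_ne_zero (x : realization G) : x.1 (label x) ≠ 0 :=
  (lt_of_lt_of_le (by norm_num) (half_le_label x)).ne'

/-- The coordinate of `y` at its label is at least `1 / 2`, and passing to `x` changes it by less.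
Thus labels of nearby points all lie in the support of one point, which has at most two vertices. -/
theorem label_ne_zero_of_dist {x y : realization G} (h : dist x y < 1 / 2) :
    x.1 (label y) ≠ 0 := by
  have h1 := half_le_label y
  have h2 := (abs_lt.1 ((abs_sub_le_dist x y (label y)).trans_lt h)).1
  linarith

theorem label_edgePoint {a b : V} (h : a = b ∨ G.Adj a b) (s : I) :
    label (edgePoint h s) = a ∨ label (edgePoint h s) = b := by
  by_contra! hc
  exact label_ne_zero (edgePoint h s) (by simp [edgePoint_apply, hc.1, hc.2])

theorem label_vertexPoint (v : V) : label (vertexPoint G v) = v :=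
  (label_edgePoint (G := G) (.inl (Eq.refl v)) 0).elim id id

/-- A homotopy of the realizations of simplicial maps gives walks along which the vertices move, which
are compatible with the edges. -/
theorem exists_words_of_homotopic {f g : SimplicialMap G H} (hfg : f.Homotopic g) :
    ∃ Γ : V → List W, (∀ v, (Γ v).IsChain fun a b => a = b ∨ H.Adj a b) ∧
      (∀ v, (Γ v).head? = some (f.toFun v)) ∧ (∀ v, (Γ v).getLast? = some (g.toFun v)) ∧
      ∀ v w, G.Adj v w → WordEquiv ([f.toFun v, f.toFun w] ++ Γ w)
        (Γ v ++ [g.toFun v, g.toFun w]) := by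
  obtain ⟨F⟩ := hfg
  have : CompactSpace (realization G) := by
    rw [← isCompact_iff_compactSpace]
    apply IsClosed.isCompact
    have : realization G = ⋃ e : {e : V × V // e.1 = e.2 ∨ G.Adj e.1 e.2},
        ⋂ v : {v : V // ¬ (v = e.1.1 ∨ v = e.1.2)}, {x : stdSimplex ℝ V | x v = 0} := by
      ext x
      simp only [realization, Set.mem_ofPred_eq, Set.mem_iUnion, Set.mem_iInter, Subtype.forall,
        Subtype.exists, Prod.exists]
      constructor
      · rintro ⟨a, b, h, h'⟩
        exact ⟨a, b, h, fun v hv => not_not.1 fun h0 => hv (h' v h0)⟩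
      · rintro ⟨a, b, h, h'⟩
        exact ⟨a, b, h, fun v hv => not_not.1 fun h0 => hv (h' v h0)⟩
    rw [this]
    refine isClosed_iUnion_of_finite fun e => isClosed_iInter fun v => ?_
    exact isClosed_eq ((continuous_apply (v : V)).comp continuous_subtype_val) continuous_const
  have hF : UniformContinuous F := CompactSpace.uniformContinuous_of_continuous F.continuous
  obtain ⟨δ, hδ, hFδ⟩ := Metric.uniformContinuous_iff.1 hF (1 / 2) (by norm_num)
  obtain ⟨N, hN⟩ := exists_nat_one_div_lt hδ
  -- Equally spaced parameters with mesh `1 / (N + 1) < δ`, clamped so that the distance estimate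
  -- holds for every `i`.
  let τ : ℕ → I := fun i => Set.projIcc 0 1 zero_le_one ((i : ℝ) / (N + 1 : ℕ))
  have hτ0 : τ 0 = 0 := by simp [τ]
  have hτ1 : τ (N + 1) = 1 := by
    have : ((N + 1 : ℕ) : ℝ) / (N + 1 : ℕ) = 1 := div_self (by positivity)
    simp only [τ, this]
    exact Set.projIcc_right _
  have hτ : ∀ i, dist (τ i) (τ (i + 1)) < δ := by
    intro i
    refine lt_of_le_of_lt ?_ hN
    refine (((LipschitzWith.projIcc (zero_le_one (α := ℝ))).dist_le_mul _ _).trans_eq ?_)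
    rw [NNReal.coe_one, one_mul, Real.dist_eq, abs_sub_comm]
    have : ((i + 1 : ℕ) : ℝ) / (N + 1 : ℕ) - (i : ℝ) / (N + 1 : ℕ) = 1 / (N + 1) := by
      push_cast; ring
    rw [this, abs_of_nonneg (by positivity)]
  have close : ∀ {x y : I × realization G}, dist x.1 y.1 < δ → dist x.2 y.2 < δ →
      (F x).1 (label (F y)) ≠ 0 := fun h1 h2 =>
    label_ne_zero_of_dist (hFδ (by rw [Prod.dist_eq]; exact max_lt h1 h2))
  refine ⟨fun v => (List.range (N + 1 + 1)).map fun i => label (F (τ i, vertexPoint G v)),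
    fun v => ?_, fun v => ?_, fun v => ?_, fun v w hvw => ?_⟩
  · rw [List.isChain_map, List.isChain_iff_getElem]
    intro i hi
    simp only [List.getElem_range]
    exact eq_or_adj_of_ne_zero (F (τ i, vertexPoint G v)) (label_ne_zero _)
      (close (hτ i) (by simpa using hδ))
  · simp [List.range_succ_eq_map, hτ0, realize_vertexPoint, label_vertexPoint]
  · simp [List.range_succ, hτ1, realize_vertexPoint, label_vertexPoint]
  · have he : v = w ∨ G.Adj v w := .inr hvw
    -- Here `i` is time and `j` the position on the edge: the extreme rows are the images of the
    -- edge under `f` and `g`, the extreme columns the words at `v` and `w`.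
    have hgrid := grid_equiv (fun i j => label (F (τ i, edgePoint he (τ j)))) (N + 1) ?_
    · simp only [hτ0, hτ1, edgePoint_zero, edgePoint_one, F.apply_zero, F.apply_one,
        realize_edgePoint] at hgrid
      have side : ∀ k : SimplicialMap G H, WordEquiv ((List.range (N + 1 + 1)).map fun j =>
          label (edgePoint (k.map_eq_or_adj he) (τ j))) [k.toFun v, k.toFun w] := by
        intro k
        refine equiv_pair_of_two_letters (x := k.toFun v) (y := k.toFun w) ?_ ?_ ?_
        · simp only [List.mem_map]
          rintro z ⟨j, -, rfl⟩
          exact label_edgePoint _ _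
        · simp [List.range_succ_eq_map, hτ0, edgePoint_zero, label_vertexPoint]
        · simp [List.range_succ, hτ1, edgePoint_one, label_vertexPoint]
      exact ((side f).symm.append_right _).trans (hgrid.trans ((side g).append_left _))
    · intro i _ j _
      have hd : ∀ j, dist (edgePoint he (τ j)) (edgePoint he (τ (j + 1))) < δ := fun j =>
        (dist_edgePoint_le he _ _).trans_lt (hτ j)
      -- All four corner labels lie in the support of the value at the corner `(i, j)`, so at most
      -- two letters occur around the square.
      have h00 := label_ne_zero (F (τ i, edgePoint he (τ j)))
      have h01 := close (x := (τ i, edgePoint he (τ j))) (y := (τ i, edgePoint he (τ (j + 1))))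
        (by simpa using hδ) (hd j)
      have h10 := close (x := (τ i, edgePoint he (τ j))) (y := (τ (i + 1), edgePoint he (τ j)))
        (hτ i) (by simpa using hδ)
      have h11 := close (x := (τ i, edgePoint he (τ j)))
        (y := (τ (i + 1), edgePoint he (τ (j + 1)))) (hτ i) (hd j)
      exact (equiv_middle (eq_of_three_ne_zero _ h00 h01 h11)).trans
        (equiv_middle (eq_of_three_ne_zero _ h00 h10 h11)).symm

end Realization
end GraphHomotopy

namespace GraphHomotopy
open SimpleGraph unitInterval

/-! ### Filling a square from a homotopy of its two boundary paths. -/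

section Square

open Topology

variable {X : Type*} [TopologicalSpace X] {x₀ x₁ y₀ y₁ : X}

/-- A homotopy between the two sides of a square fills the square. -/
theorem exists_square {B : Path x₀ x₁} {R : Path x₁ y₁} {L : Path x₀ y₀} {T : Path y₀ y₁}
    (h : (B.trans R).Homotopic (L.trans T)) :
    ∃ Q : I × I → X, Continuous Q ∧ (∀ s, Q (0, s) = B s) ∧ (∀ s, Q (1, s) = T s) ∧
      (∀ t, Q (t, 0) = L t) ∧ ∀ t, Q (t, 1) = R t := by
  obtain ⟨K⟩ := h
  -- `τ` is the path parameter and `η` the homotopy parameter. The sides carrying `B` and `R` go to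
  -- `η = 0`, those carrying `L` and `T` to `η = 1`, apart from the corners `(0, 0)` and `(1, 1)`,
  -- where the denominator of `ρ` vanishes.
  let τ : I × I → I := fun p => ⟨((p.2 : ℝ) + p.1) / 2, by
    have := p.1.2; have := p.2.2; simp only [Set.mem_Icc] at *; constructor <;> linarith⟩
  have hτ : Continuous τ := Continuous.subtype_mk (by fun_prop) _
  let ρ : I × I → ℝ := fun p => p.1 * (1 - p.2) / (p.1 * (1 - p.2) + p.2 * (1 - p.1))
  have nonneg : ∀ p : I × I, 0 ≤ (p.1 : ℝ) * (1 - p.2) ∧ 0 ≤ (p.2 : ℝ) * (1 - p.1) := fun p =>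
    ⟨mul_nonneg p.1.2.1 (sub_nonneg.2 p.2.2.2), mul_nonneg p.2.2.1 (sub_nonneg.2 p.1.2.2)⟩
  let η : I × I → I := fun p => Set.projIcc 0 1 zero_le_one (ρ p)
  have hK0 : ∀ p, (τ p : ℝ) = 0 → K (η p, τ p) = x₀ := fun p hp => by
    rw [show τ p = 0 from Subtype.ext hp]; exact K.source _
  have hK1 : ∀ p, (τ p : ℝ) = 1 → K (η p, τ p) = y₁ := fun p hp => by
    rw [show τ p = 1 from Subtype.ext hp]; exact K.target _
  -- At the two bad corners `K` does not depend on `η`; by the tube lemma continuity there needs no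
  -- control of `η`.
  have corner : ∀ (c : I) (z : X), (∀ u, K (u, c) = z) → ∀ p, τ p = c →
      ContinuousAt (fun p => K (η p, τ p)) p := by
    intro c z hz p hp
    rw [ContinuousAt, hp, hz]
    rw [tendsto_nhds]
    intro U hU hzU
    obtain ⟨u, v, -, hv, hu', hv', huv⟩ := generalized_tube_lemma (isCompact_univ (X := I))
      (isCompact_singleton (x := c)) (hU.preimage K.continuous) (by
        rintro ⟨a, b⟩ ⟨-, hb⟩
        obtain rfl : b = c := hb
        simpa [hz] using hzU)
    filter_upwards [hτ.continuousAt.preimage_mem_nhds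
      (hv.mem_nhds (by rw [hp]; exact hv' rfl))] with q hq
    exact huv (Set.mk_mem_prod (hu' (Set.mem_univ _)) hq)
  refine ⟨fun p => K (η p, τ p), ?_, ?_, ?_, ?_, ?_⟩
  · rw [continuous_iff_continuousAt]
    intro p
    by_cases hp : (p.1 : ℝ) * (1 - p.2) + p.2 * (1 - p.1) = 0
    · have h1 : (p.1 : ℝ) * (1 - p.2) = 0 := by linarith [nonneg p]
      have h2 : (p.2 : ℝ) * (1 - p.1) = 0 := by linarith [nonneg p]
      by_cases h3 : (p.1 : ℝ) = 0
      · have h4 : (p.2 : ℝ) = 0 := by simpa [h3] using h2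
        exact corner 0 x₀ K.source p (Subtype.ext (by simp [τ, h3, h4]))
      · have h4 : (p.2 : ℝ) = 1 := by
          have := (mul_eq_zero.1 h1).resolve_left h3; linarith
        have h5 : (p.1 : ℝ) = 1 := by rw [h4] at h2; linarith
        exact corner 1 y₁ K.target p (Subtype.ext (by simp [τ, h4, h5]))
    · have hρ : ContinuousAt ρ p := by
        refine ContinuousAt.div ?_ ?_ hp <;> fun_prop
      exact K.continuous.continuousAt.comp
        ((continuous_projIcc.continuousAt.comp hρ).prodMk hτ.continuousAt)
  · intro s
    have hη : η (0, s) = 0 := by simp [η, ρ]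
    have hτs : (τ (0, s) : ℝ) ≤ 1 / 2 := by simp [τ]; linarith [s.2.2]
    simp only [hη, K.apply_zero, Path.coe_toContinuousMap, Path.trans_apply, dif_pos hτs]
    congr 1
    exact Subtype.ext (by simp [τ]; ring)
  · intro s
    -- At this corner `0 / 0 = 0` gives `η = 0` rather than `1`, so the value comes from the fixed
    -- endpoint of `K`.
    by_cases hs : (s : ℝ) = 1
    · obtain rfl : s = 1 := Subtype.ext hs
      refine (hK1 _ (by simp [τ])).trans T.target.symm
    have hs' : 1 - (s : ℝ) ≠ 0 := sub_ne_zero.2 (Ne.symm hs)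
    have hη : η (1, s) = 1 := by simp [η, ρ, div_self hs']
    simp only [hη, K.apply_one, Path.coe_toContinuousMap, Path.trans_apply]
    split_ifs with h1
    · have h2 : (s : ℝ) = 0 := by simp [τ] at h1; linarith [s.2.1]
      obtain rfl : s = 0 := Subtype.ext h2
      rw [T.source]
      convert L.target
      simp [τ]
    · congr 1
      exact Subtype.ext (by simp [τ]; ring)
  · intro t
    by_cases ht : (t : ℝ) = 0
    · obtain rfl : t = 0 := Subtype.ext ht
      refine (hK0 _ (by simp [τ])).trans L.source.symm
    have hη : η (t, 0) = 1 := by simp [η, ρ, div_self ht]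
    have hτs : (τ (t, 0) : ℝ) ≤ 1 / 2 := by simp [τ]; linarith [t.2.2]
    simp only [hη, K.apply_one, Path.coe_toContinuousMap, Path.trans_apply, dif_pos hτs]
    congr 1
    exact Subtype.ext (by simp [τ]; ring)
  · intro t
    have hη : η (t, 1) = 0 := by simp [η, ρ]
    simp only [hη, K.apply_zero, Path.coe_toContinuousMap, Path.trans_apply]
    split_ifs with h1
    · have h2 : (t : ℝ) = 0 := by simp [τ] at h1; linarith [t.2.1]
      obtain rfl : t = 0 := Subtype.ext h2
      rw [R.source]
      convert B.target
      simp [τ]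
    · congr 1
      exact Subtype.ext (by simp [τ]; ring)

end Square

/-! ### Words as morphisms of the fundamental groupoid, and gluing of homotopies. -/

section Morphisms

open CategoryTheory

variable {W : Type*} [Fintype W] [DecidableEq W] {H : SimpleGraph W}

/-- The path along a (possibly degenerate) edge. -/
noncomputable def edgePath {a b : W} (h : a = b ∨ H.Adj a b) :
    Path (vertexPoint H a) (vertexPoint H b) where
  toFun := edgePoint h
  continuous_toFun := by
    refine Continuous.subtype_mk (Continuous.subtype_mk (continuous_pi fun v => ?_) _) _
    fun_prop
  source' := edgePoint_zero h
  target' := edgePoint_one h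

variable (H) in
/-- A vertex as an object of the fundamental groupoid of the realization. -/
noncomputable abbrev vertexObj (a : W) : FundamentalGroupoid (realization H) := ⟨vertexPoint H a⟩

/-- The class of the path along an edge. -/
noncomputable def edgeHom {a b : W} (h : a = b ∨ H.Adj a b) : vertexObj H a ⟶ vertexObj H b :=
  Path.Homotopic.Quotient.mk (edgePath h)

theorem edgeHom_self {a : W} (h : a = a ∨ H.Adj a a) : edgeHom h = 𝟙 (vertexObj H a) := by
  have : edgePath h = Path.refl _ := Path.ext (funext fun s => edgePoint_self h s)
  rw [edgeHom, this]
  rfl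

theorem edgeHom_comp {a b : W} (h : a = b ∨ H.Adj a b) (h' : b = a ∨ H.Adj b a) :
    edgeHom h ≫ edgeHom h' = 𝟙 (vertexObj H a) := by
  have : edgePath h' = (edgePath h).symm :=
    Path.ext (funext fun s => (edgePoint_symm h h' s).symm)
  rw [edgeHom, edgeHom, this]
  exact Path.Homotopic.Quotient.trans_symm _

/-- `WordHom l φ`: the list of vertices `l` is a lazy walk, and `φ` is its class in the fundamental
groupoid. -/
inductive WordHom : List W → ∀ {a b : W}, (vertexObj H a ⟶ vertexObj H b) → Prop
  | single (a : W) : WordHom [a] (𝟙 (vertexObj H a))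
  | cons {l : List W} {a b c : W} (h : a = b ∨ H.Adj a b) {φ : vertexObj H b ⟶ vertexObj H c}
      (hl : WordHom l φ) : WordHom (a :: l) (edgeHom h ≫ φ)

theorem WordHom.head?_eq {l : List W} {a b : W} {φ : vertexObj H a ⟶ vertexObj H b}
    (h : WordHom l φ) : l.head? = some a := by
  cases h <;> rfl

/-- The cancelling cases of `push` mirror groupoid identities: a degenerate edge is an identity, and
an edge followed by its reverse cancels. -/
theorem WordHom.push {l : List W} {a b c : W} (h : a = b ∨ H.Adj a b)
    {φ : vertexObj H b ⟶ vertexObj H c} (hl : WordHom l φ) :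
    WordHom (push a l) (edgeHom h ≫ φ) := by
  cases hl with
  | single =>
    rw [GraphHomotopy.push]
    split_ifs with h1 h2
    · subst h1
      rw [edgeHom_self, Category.id_comp]
      exact .single a
    · simp at h2
    · exact .cons h (.single b)
  | @cons l _ b' _ h' ψ hl =>
    rw [GraphHomotopy.push]
    split_ifs with h1 h2
    · subst h1
      rw [edgeHom_self, Category.id_comp]
      exact .cons h' hl
    · rw [hl.head?_eq, Option.some.injEq] at h2
      subst h2
      rw [← Category.assoc, edgeHom_comp, Category.id_comp]
      exact hl
    · exact .cons h (.cons h' hl)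

theorem WordHom.reduce {l : List W} {a b : W} {φ : vertexObj H a ⟶ vertexObj H b}
    (hl : WordHom l φ) : WordHom (reduce l) φ := by
  induction hl with
  | single a => exact .single a
  | cons h _ ih => exact ih.push h

theorem WordHom.unique {l : List W} {a b : W} {φ ψ : vertexObj H a ⟶ vertexObj H b}
    (hφ : WordHom l φ) (hψ : WordHom l ψ) : φ = ψ := by
  induction hφ with
  | single a =>
    cases hψ with
    | single => rfl
    | cons h hl => cases hl
  | @cons l a b c h φ hl ih =>
    cases hψ with
    | single => cases hl
    | cons h' hl' =>
      have := hl.head?_eq.symm.trans hl'.head?_eq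
      rw [Option.some.injEq] at this
      subst this
      rw [ih hl']

/-- Both words reduce to one list, and a list determines its class. This turns combinatorial
equivalences into equalities of path classes. -/
theorem WordHom.eq_of_equiv {l l' : List W} (h : WordEquiv l l') {a b : W}
    {φ ψ : vertexObj H a ⟶ vertexObj H b} (hφ : WordHom l φ) (hψ : WordHom l' ψ) : φ = ψ := by
  have := hφ.reduce
  rw [h] at this
  exact this.unique hψ.reduce

theorem WordHom.append {p q : List W} {a b c : W} {φ : vertexObj H a ⟶ vertexObj H b}
    {ψ : vertexObj H b ⟶ vertexObj H c} (hp : WordHom p φ) (hq : WordHom q ψ) :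
    WordHom (p ++ q) (φ ≫ ψ) := by
  induction hp with
  | single a =>
    have := WordHom.cons (.inl rfl) hq
    rwa [edgeHom_self] at this
  | cons h _ ih =>
    rw [Category.assoc]
    exact .cons h (ih hq)

theorem exists_wordHom {l : List W} (hl : l.IsChain fun a b => a = b ∨ H.Adj a b) {a b : W}
    (ha : l.head? = some a) (hb : l.getLast? = some b) :
    ∃ φ : vertexObj H a ⟶ vertexObj H b, WordHom l φ := by
  induction l generalizing a with
  | nil => simp at ha
  | cons c l ih =>
    obtain rfl : c = a := by simpa using ha
    cases l with
    | nil =>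
      obtain rfl : c = b := by simpa using hb
      exact ⟨_, .single c⟩
    | cons d l =>
      obtain ⟨φ, hφ⟩ := ih hl.tail rfl (by simpa using hb)
      exact ⟨_, .cons (hl.rel_head? (by simp)) hφ⟩

variable {V : Type*} {G : SimpleGraph V}

/-- The class of the image of a walk under a simplicial map. -/
noncomputable def SimplicialMap.walkHom (f : SimplicialMap G H) :
    ∀ {u v : V}, G.Walk u v → (vertexObj H (f.toFun u) ⟶ vertexObj H (f.toFun v))
  | _, _, .nil => 𝟙 _
  | _, _, .cons h p => edgeHom (f.map_adj _ _ h) ≫ f.walkHom p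

theorem SimplicialMap.wordHom_walkHom (f : SimplicialMap G H) {u v : V} (p : G.Walk u v) :
    WordHom (p.support.map f.toFun) (f.walkHom p) := by
  induction p with
  | nil => exact .single _
  | cons h p ih => exact .cons _ ih

theorem SimplicialMap.walkHom_append (f : SimplicialMap G H) {u v w : V} (p : G.Walk u v)
    (q : G.Walk v w) : f.walkHom (p.append q) = f.walkHom p ≫ f.walkHom q := by
  induction p with
  | nil => simp [walkHom]
  | cons h p ih => simp [walkHom, ih]

theorem SimplicialMap.walkHom_comp_reverse (f : SimplicialMap G H) {u v : V} (p : G.Walk u v) :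
    f.walkHom p ≫ f.walkHom p.reverse = 𝟙 _ := by
  induction p with
  | nil => simp [walkHom]
  | cons h p ih =>
    rw [Walk.reverse_cons, walkHom_append, walkHom, Category.assoc, ← Category.assoc (f.walkHom p),
      ih, Category.id_comp]
    simp [walkHom, edgeHom_comp]

/-- Paths along which the vertices move, compatible with the edges, give a homotopy. -/
theorem homotopic_of_natural {V : Type*} [Fintype V] [LinearOrder V] {G : SimpleGraph V}
    {f g : SimplicialMap G H}
    (η : ∀ v, vertexObj H (f.toFun v) ⟶ vertexObj H (g.toFun v))
    (hη : ∀ v w, ∀ h : G.Adj v w,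
      edgeHom (f.map_adj v w h) ≫ η w = η v ≫ edgeHom (g.map_adj v w h)) :
    f.Homotopic g := by
  have hη' : ∀ v w, ∀ h : v = w ∨ G.Adj v w,
      edgeHom (f.map_eq_or_adj h) ≫ η w = η v ≫ edgeHom (g.map_eq_or_adj h) := by
    rintro v w (rfl | h)
    · rw [edgeHom_self, edgeHom_self, Category.id_comp, Category.comp_id]
    · exact hη v w h
  choose Γ hΓ using fun v => Path.Homotopic.Quotient.mk_surjective (η v)
  -- The order picks one orientation of each edge; degenerate edges are kept so that isolated
  -- vertices are covered.
  let E := {e : V × V // e.1 ≤ e.2 ∧ (e.1 = e.2 ∨ G.Adj e.1 e.2)}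
  have hsq : ∀ e : E, ∃ Q : I × I → realization H, Continuous Q ∧
      (∀ s, Q (0, s) = edgePoint (f.map_eq_or_adj e.2.2) s) ∧
      (∀ s, Q (1, s) = edgePoint (g.map_eq_or_adj e.2.2) s) ∧
      (∀ t, Q (t, 0) = Γ e.1.1 t) ∧ ∀ t, Q (t, 1) = Γ e.1.2 t := by
    intro e
    refine exists_square (B := edgePath (f.map_eq_or_adj e.2.2))
      (T := edgePath (g.map_eq_or_adj e.2.2)) (Path.Homotopic.Quotient.exact ?_)
    have := hη' _ _ e.2.2
    rw [← hΓ, ← hΓ] at this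
    exact this
  choose Q hQ hQ0 hQ1 hQL hQR using hsq
  let S : E → Set (I × realization G) := fun e =>
    {p | ∀ v, v ≠ e.1.1 → v ≠ e.1.2 → p.2.1 v = 0}
  let c : V → I × realization G → I := fun v p => ⟨p.2.1 v, stdSimplex.zero_le p.2.1 v, stdSimplex.le_one p.2.1 v⟩
  have hc : ∀ v, Continuous (c v) := fun v => Continuous.subtype_mk
    ((continuous_apply v).comp (continuous_subtype_val.comp
      (continuous_subtype_val.comp continuous_snd))) _
  have cover : ∀ p, ∃ e, p ∈ S e := by
    intro p
    obtain ⟨a, b, hab, h⟩ := p.2.2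
    rcases le_total a b with hle | hle
    · refine ⟨⟨(a, b), hle, hab⟩, fun v hva hvb => not_not.1 fun h0 => ?_⟩
      exact (h v h0).elim hva hvb
    · refine ⟨⟨(b, a), hle, hab.imp Eq.symm SimpleGraph.Adj.symm⟩,
        fun v hva hvb => not_not.1 fun h0 => ?_⟩
      exact (h v h0).elim hvb hva
  have hsum : ∀ (e : E) p, p ∈ S e → e.1.1 ≠ e.1.2 → p.2.1 e.1.1 + p.2.1 e.1.2 = 1 := by
    intro e p hp hne
    rw [← stdSimplex.sum_eq_one p.2.1, ← Finset.sum_pair hne]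
    refine Finset.sum_subset (Finset.subset_univ _) fun v _ hv => ?_
    simp only [Finset.mem_insert, Finset.mem_singleton, not_or] at hv
    exact hp v hv.1 hv.2
  have hone : ∀ (e : E) p, p ∈ S e → e.1.1 = e.1.2 → p.2.1 e.1.2 = 1 := by
    intro e p hp heq
    rw [← stdSimplex.sum_eq_one p.2.1, Finset.sum_eq_single e.1.2]
    · intro v _ hv
      exact hp v (heq ▸ hv) hv
    · simp
  have point : ∀ (e : E) p, p ∈ S e → p.2 = edgePoint e.2.2 (c e.1.2 p) := by
    intro e p hp
    refine realization_ext fun v => ?_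
    rw [edgePoint_apply]
    change p.2.1 v = (1 - p.2.1 e.1.2) * _ + p.2.1 e.1.2 * _
    by_cases heq : e.1.1 = e.1.2
    · rw [hone e p hp heq, heq]
      by_cases hv : v = e.1.2
      · rw [hv, hone e p hp heq]; simp
      · rw [hp v (heq ▸ hv) hv]; simp [hv]
    · have h1 := hsum e p hp heq
      by_cases hv : v = e.1.2
      · simp [hv, Ne.symm heq]
      · by_cases hv' : v = e.1.1
        · rw [hv']; simp [heq]; linarith
        · rw [hp v hv' hv]; simp [hv, hv']
  have vertex : ∀ (e : E) p, p ∈ S e → ∀ u, p.2.1 u = 1 → Q e (p.1, c e.1.2 p) = Γ u p.1 := by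
    intro e p hp u hu
    have hue : u = e.1.1 ∨ u = e.1.2 := by
      by_contra! h
      have := hp u h.1 h.2
      linarith
    by_cases h2 : u = e.1.2
    · have : c e.1.2 p = 1 := Subtype.ext (by rw [← h2]; exact hu)
      rw [this, hQR, h2]
    · have h1 := hue.resolve_right h2
      have : c e.1.2 p = 0 := Subtype.ext (by
        have := hsum e p hp (h1 ▸ h2)
        rw [← h1] at this
        change p.2.1 e.1.2 = 0
        linarith)
      rw [this, hQL, h1]
  have agree : ∀ (e e' : E) p, p ∈ S e → p ∈ S e' →
      Q e (p.1, c e.1.2 p) = Q e' (p.1, c e'.1.2 p) := by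
    intro e e' p hp hp'
    by_cases hu : ∃ u, p.2.1 u = 1
    · obtain ⟨u, hu⟩ := hu
      rw [vertex e p hp u hu, vertex e' p hp' u hu]
    -- Away from the vertices both coordinates on `e` are nonzero, so `e` and `e'` have the same
    -- ends, and the order makes them equal.
    · push Not at hu
      suffices e = e' by rw [this]
      have hne : e.1.1 ≠ e.1.2 := fun h => hu _ (hone e p hp h)
      have h1 := hsum e p hp hne
      have hn1 : p.2.1 e.1.1 ≠ 0 := fun h => hu e.1.2 (by linarith)
      have hn2 : p.2.1 e.1.2 ≠ 0 := fun h => hu e.1.1 (by linarith)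
      have h3 : e.1.1 = e'.1.1 ∨ e.1.1 = e'.1.2 := by
        by_contra! h; exact hn1 (hp' _ h.1 h.2)
      have h4 : e.1.2 = e'.1.1 ∨ e.1.2 = e'.1.2 := by
        by_contra! h; exact hn2 (hp' _ h.1 h.2)
      have h5 := e.2.1
      have h6 := e'.2.1
      refine Subtype.ext (Prod.ext ?_ ?_) <;> grind
  choose ε hε using cover
  let F : I × realization G → realization H := fun p => Q (ε p) (p.1, c (ε p).1.2 p)
  have hF : ∀ e p, p ∈ S e → F p = Q e (p.1, c e.1.2 p) := fun e p hp =>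
    agree _ _ p (hε p) hp
  have hFc : Continuous F := by
    refine LocallyFinite.continuous (f := S) (locallyFinite_of_finite S) ?_ ?_ ?_
    · exact Set.eq_univ_of_forall fun p => Set.mem_iUnion.2 ⟨_, hε p⟩
    · intro e
      have : S e = ⋂ v, ⋂ (_ : v ≠ e.1.1), ⋂ (_ : v ≠ e.1.2), {p | c v p = 0} := by
        ext p
        simp only [S, Set.mem_ofPred_eq, Set.mem_iInter, c, ← Subtype.coe_inj, Set.Icc.coe_zero]
      rw [this]
      exact isClosed_iInter fun v => isClosed_iInter fun _ => isClosed_iInter fun _ =>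
        isClosed_eq (hc v) continuous_const
    · intro e
      have : Continuous fun p : I × realization G => Q e (p.1, c e.1.2 p) :=
        (hQ e).comp (continuous_fst.prodMk (hc _))
      exact this.continuousOn.congr fun p hp => hF e p hp
  refine ⟨⟨⟨F, hFc⟩, fun x => ?_, fun x => ?_⟩⟩
  · have h1 := hQ0 (ε (0, x)) (c (ε (0, x)).1.2 (0, x))
    refine h1.trans ?_
    rw [← realize_edgePoint f (ε (0, x)).2.2, ← point _ _ (hε (0, x))]
  · have h1 := hQ1 (ε (1, x)) (c (ε (1, x)).1.2 (1, x))
    refine h1.trans ?_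
    rw [← realize_edgePoint g (ε (1, x)).2.2, ← point _ _ (hε (1, x))]

end Morphisms

/-! ### Homotopy of simplicial maps as simultaneous conjugacy. -/

section Criterion

open CategoryTheory

variable {V W : Type*} [Fintype V] [Fintype W] [LinearOrder V] [DecidableEq W]
  {G : SimpleGraph V} {H : SimpleGraph W}

/-- Two simplicial maps are homotopic if and only if for each vertex `v` there is a walk which
conjugates the images of short closed walks at `v`. -/
theorem simplicialMap_homotopic_iff {f g : SimplicialMap G H} {C : ℕ}
    (hC : 2 * Fintype.card V ≤ C) :
    f.Homotopic g ↔ ∀ v, ∃ γ : List W, IsConjugator H.Adj (f.toFun v) (g.toFun v)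
      (fun p : {p : G.Walk v v // p.support.length ≤ C} => p.1.support.map f.toFun)
      (fun p => p.1.support.map g.toFun) γ := by
  constructor
  · intro h v
    obtain ⟨Γ, hΓ, hf, hg, hfg⟩ := exists_words_of_homotopic h
    have key : ∀ {u w : V} (p : G.Walk u w),
        WordEquiv (p.support.map f.toFun ++ Γ w) (Γ u ++ p.support.map g.toFun) := by
      intro u w p
      induction p with
      | @nil u =>
        exact (equiv_cons_of_head? (hf u)).trans (equiv_concat_of_getLast? (hg u)).symm
      | @cons u v w h p ih =>
        have hm : ∀ k : SimplicialMap G H, WordEquiv ((Walk.cons h p).support.map k.toFun)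
            ([k.toFun u, k.toFun v] ++ p.support.map k.toFun) := by
          intro k
          rw [Walk.support_cons, List.map_cons]
          refine (equiv_cons_of_head? ?_).symm.cons _
          simp [head?_support]
        calc WordEquiv ((Walk.cons h p).support.map f.toFun ++ Γ w)
              ([f.toFun u, f.toFun v] ++ (p.support.map f.toFun ++ Γ w)) := by
              simpa using (hm f).append_right (Γ w)
          WordEquiv _ ([f.toFun u, f.toFun v] ++ (Γ v ++ p.support.map g.toFun)) :=
              ih.append_left _
          WordEquiv _ (Γ u ++ [g.toFun u, g.toFun v] ++ p.support.map g.toFun) := by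
              simpa using (hfg u v h).append_right (p.support.map g.toFun)
          WordEquiv _ (Γ u ++ (Walk.cons h p).support.map g.toFun) := by
              simpa using (hm g).symm.append_left (Γ u)
    refine ⟨reduce (Γ v), isChain_reduce (hΓ v), by rw [head?_reduce, hf],
      by rw [getLast?_reduce, hg], fun p => ?_⟩
    rw [conj_equiv_iff (x := f.toFun v) (y := g.toFun v) (by rw [head?_reduce, hf])
      (by rw [getLast?_reduce, hg]) (by simp [head?_support]) (by simp [head?_support])]
    exact ((equiv_reduce _).append_left _).trans
      ((key p.1).trans ((equiv_reduce _).symm.append_right _))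
  · intro h
    have hκ : ∀ v, ∃ κ : vertexObj H (f.toFun v) ⟶ vertexObj H (g.toFun v),
        ∀ p : G.Walk v v, p.support.length ≤ C → f.walkHom p ≫ κ = κ ≫ g.walkHom p := by
      intro v
      obtain ⟨γ, hγ⟩ := h v
      obtain ⟨κ, hκ⟩ := exists_wordHom (hγ.isChain.imp fun _ _ => Or.inr) hγ.head hγ.last
      refine ⟨κ, fun p hp => ?_⟩
      have := hγ.conj ⟨p, hp⟩
      rw [conj_equiv_iff hγ.head hγ.last (by simp [head?_support])
        (by simp [head?_support])] at this
      exact WordHom.eq_of_equiv this ((f.wordHom_walkHom p).append hκ)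
        (hκ.append (g.wordHom_walkHom p))
    choose κ hκ using hκ
    -- One base vertex in each component; its path class is transported to the other vertices along
    -- chosen short paths.
    let r : V → V := fun v => (G.connectedComponentMk v).out
    have hP : ∀ v, ∃ p : G.Walk (r v) v, p.length < Fintype.card V := by
      intro v
      have : G.Reachable (r v) v := ConnectedComponent.exact (Quot.out_eq _)
      obtain ⟨p⟩ := this
      exact ⟨p.toPath, p.toPath.2.length_lt⟩
    choose P hP using hP
    refine homotopic_of_natural
      (fun v => f.walkHom (P v).reverse ≫ κ (r v) ≫ g.walkHom (P v)) fun v w hvw => ?_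
    have hr : r v = r w := by
      simp only [r, ConnectedComponent.sound hvw.reachable]
    have hPv := hP v
    have hPw := hP w
    generalize P v = p at hPv ⊢
    generalize P w = q at hPw ⊢
    revert p q
    rw [← hr]
    intro p hp q hq
    -- Naturality at the edge is commutation with this loop. Each path has at most `card V - 1`
    -- edges, so the loop lists at most `2 * card V` vertices, whence the bound on `C`.
    have hloop := hκ (r v) (p.append (Walk.cons hvw q.reverse)) (by
      rw [Walk.length_support, Walk.length_append, Walk.length_cons, Walk.length_reverse]
      omega)
    simp only [SimplicialMap.walkHom_append, SimplicialMap.walkHom, Category.assoc] at hloop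
    have hf1 : f.walkHom p.reverse ≫ f.walkHom p = 𝟙 _ := by
      simpa using f.walkHom_comp_reverse p.reverse
    have hg1 : g.walkHom q.reverse ≫ g.walkHom q = 𝟙 _ := by
      simpa using g.walkHom_comp_reverse q.reverse
    have := congrArg (fun φ => f.walkHom p.reverse ≫ φ ≫ g.walkHom q) hloop
    simp only [Category.assoc, hg1, Category.comp_id] at this
    rw [← Category.assoc (f.walkHom p.reverse) (f.walkHom p), hf1, Category.id_comp] at this
    simpa using this

end Criterion

end GraphHomotopy

namespace GraphHomotopy
open SimpleGraph

/-! ### Enumeration of words of bounded length. -/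

section Enumeration

variable {α β : Type*}

/-- All lists of length at most `k` with entries in a given list. -/
def allLists (vs : List α) : ℕ → List (List α)
  | 0 => [[]]
  | k + 1 => [] :: vs.flatMap fun a => (allLists vs k).map (a :: ·)

theorem mem_allLists {vs : List α} {k : ℕ} {l : List α} :
    l ∈ allLists vs k ↔ l.length ≤ k ∧ ∀ x ∈ l, x ∈ vs := by
  induction k generalizing l with
  | zero =>
    rw [allLists, List.mem_singleton, Nat.le_zero, List.length_eq_zero_iff]
    constructor
    · rintro rfl; simp
    · exact fun h => h.1
  | succ k ih =>
    cases l with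
    | nil => simp [allLists]
    | cons a l => simp [allLists, ih]; tauto

theorem allLists_map (f : α → β) (vs : List α) (k : ℕ) :
    allLists (vs.map f) k = (allLists vs k).map (List.map f) := by
  induction k with
  | zero => rfl
  | succ k ih => simp [allLists, ih, List.flatMap_map, List.map_flatMap, Function.comp_def]

theorem allLists_range (m k : ℕ) :
    allLists (List.range m) k = (allLists (List.finRange m) k).map (List.map Fin.val) := by
  rw [← allLists_map, List.map_coe_finRange_eq_range]

theorem mem_allLists_finRange {m k : ℕ} {l : List (Fin m)} :
    l ∈ allLists (List.finRange m) k ↔ l.length ≤ k := by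
  simp [mem_allLists, List.mem_finRange]

end Enumeration

/-! ### Finite tests on codes and their correctness. -/

section Tests

/-- The entry of an adjacency matrix, `false` outside of its range. -/
def entry (A : List (List Bool)) (i j : ℕ) : Bool := (A.getD i []).getD j false

/-- The consecutive entries of a list are adjacent. -/
def IsWalkCode (A : List (List Bool)) (l : List ℕ) : Prop :=
  ∀ i < l.length - 1, entry A (l.getD i 0) (l.getD (i + 1) 0) = true

/-- A search for a walk from `u` to `v` which conjugates each pair of `L`, all words of which have
length at most `C`. -/
def ConjTest (A : List (List Bool)) (C : ℕ) (u v : Option ℕ) (L : List (List ℕ × List ℕ)) : Prop :=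
  ∃ γ ∈ allLists (List.range A.length) ((allLists (List.range A.length) C).length ^ L.length),
    IsWalkCode A γ ∧ γ.head? = u ∧ γ.reverse.head? = v ∧
      ∀ pq ∈ L, reduce (γ.reverse ++ pq.1 ++ γ) = reduce pq.2

/-- The list `l` codes a closed walk at `x.2` in the graph with adjacency matrix `x.1`. -/
def IsLoopCode (l : List ℕ) (x : List (List Bool) × ℕ) : Prop :=
  IsWalkCode x.1 l ∧ l.head? = some x.2 ∧ l.reverse.head? = some x.2

open scoped Classical in
/-- The pairs of images of short closed walks at `v` under two maps. -/
noncomputable def loopPairs (A : List (List Bool)) (fl gl : List ℕ) (v : ℕ) :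
    List (List ℕ × List ℕ) :=
  ((allLists (List.range A.length) (2 * A.length)).filter fun l => IsLoopCode l (A, v)).map
    fun l => (l.map fun i => fl.getD i 0, l.map fun i => gl.getD i 0)

/-- The test for homotopy of two simplicial maps. -/
def MapTest (A B : List (List Bool)) (fl gl : List ℕ) : Prop :=
  ∀ v < A.length, ConjTest B (2 * A.length) fl[v]? gl[v]? (loopPairs A fl gl v)

theorem length_graphCode {n : ℕ} (G : SimpleGraph (Fin n)) : (graphCode G).length = n := by
  simp [graphCode]

theorem entry_graphCode {n : ℕ} (G : SimpleGraph (Fin n)) (i j : Fin n) :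
    entry (graphCode G) i j = true ↔ G.Adj i j := by
  simp [entry, graphCode]

theorem isWalkCode_map {n : ℕ} (G : SimpleGraph (Fin n)) (l : List (Fin n)) :
    IsWalkCode (graphCode G) (l.map Fin.val) ↔ l.IsChain G.Adj := by
  rw [List.isChain_iff_getElem, IsWalkCode]
  refine forall_congr' fun i => ?_
  rw [List.length_map]
  constructor
  · intro h hi
    have := h (by omega)
    rw [List.getD_eq_getElem _ _ (by simp; omega), List.getD_eq_getElem _ _ (by simpa using hi),
      List.getElem_map, List.getElem_map, entry_graphCode] at this
    exact this
  · intro h hi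
    rw [List.getD_eq_getElem _ _ (by simp; omega), List.getD_eq_getElem _ _ (by simp; omega),
      List.getElem_map, List.getElem_map, entry_graphCode]
    exact h (by omega)

theorem head?_map_val {n : ℕ} {l : List (Fin n)} {u : Fin n} :
    (l.map Fin.val).head? = some (u : ℕ) ↔ l.head? = some u := by
  cases l <;> simp [Fin.ext_iff]

theorem head?_reverse_map_val {n : ℕ} {l : List (Fin n)} {u : Fin n} :
    (l.map Fin.val).reverse.head? = some (u : ℕ) ↔ l.getLast? = some u := by
  rw [← List.map_reverse, head?_map_val, List.head?_reverse]

/-- Only the set of pairs matters, so families indexed by walks and by positions in a list are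
interchangeable. -/
theorem IsConjugator.reindex {V ι κ : Type*} [DecidableEq V] {R : V → V → Prop} {u v : V}
    {a b : ι → List V} {a' b' : κ → List V} (h : ∀ k, ∃ i, a i = a' k ∧ b i = b' k) {γ : List V}
    (hγ : IsConjugator R u v a b γ) : IsConjugator R u v a' b' γ :=
  ⟨hγ.isChain, hγ.head, hγ.last, fun k => by
    obtain ⟨i, h1, h2⟩ := h k
    rw [← h1, ← h2]
    exact hγ.conj i⟩

theorem conjTest_iff {m : ℕ} (H : SimpleGraph (Fin m)) {C : ℕ} {u v : Fin m}
    {L : List (List (Fin m) × List (Fin m))} (hL : L ≠ [])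
    (hhead : ∀ pq ∈ L, pq.1.head? = some u) (hlast : ∀ pq ∈ L, pq.1.getLast? = some u)
    (hlen : ∀ pq ∈ L, pq.1.length ≤ C ∧ pq.2.length ≤ C) :
    ConjTest (graphCode H) C (some u) (some v)
        (L.map (Prod.map (List.map Fin.val) (List.map Fin.val))) ↔
      ∃ γ, IsConjugator H.Adj u v (fun i : Fin L.length => L[i].1) (fun i => L[i].2) γ := by
  have hword : ∀ γ : List (Fin m), (∀ pq ∈ L.map (Prod.map (List.map Fin.val) (List.map Fin.val)),
      reduce ((γ.map Fin.val).reverse ++ pq.1 ++ γ.map Fin.val) = reduce pq.2) ↔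
      ∀ i : Fin L.length, WordEquiv (γ.reverse ++ L[i].1 ++ γ) L[i].2 := by
    intro γ
    rw [List.forall_mem_map, List.forall_mem_iff_forall_getElem]
    refine Iff.trans ?_ Fin.forall_iff.symm
    refine forall₂_congr fun i hi => ?_
    rw [← equiv_map_iff Fin.val_injective]
    simp [WordEquiv]
  simp only [ConjTest, length_graphCode, allLists_range, List.length_map]
  constructor
  · rintro ⟨_, hmem, h1, h2, h3, h4⟩
    obtain ⟨γ, -, rfl⟩ := List.mem_map.1 hmem
    exact ⟨γ, (isWalkCode_map H γ).1 h1, head?_map_val.1 h2, head?_reverse_map_val.1 h3,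
      (hword γ).1 h4⟩
  · rintro ⟨γ, hγ⟩
    have : Nonempty (Fin L.length) := ⟨⟨0, List.length_pos_iff.2 hL⟩⟩
    -- Completeness of the search: some conjugator lies within the bound. Duplicates in the
    -- enumeration could only enlarge that bound.
    obtain ⟨γ, hγ, hle⟩ := hγ.exists_length_le (C := C)
      (S := (allLists (List.finRange m) C).toFinset)
      (fun l hl => List.mem_toFinset.2 (mem_allLists_finRange.2 hl))
      (fun i => hhead _ (List.getElem_mem _)) (fun i => hlast _ (List.getElem_mem _))
      (fun i => (hlen _ (List.getElem_mem _)).1) (fun i => (hlen _ (List.getElem_mem _)).2)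
    refine ⟨γ.map Fin.val, List.mem_map_of_mem (mem_allLists_finRange.2 (hle.trans ?_)),
      (isWalkCode_map H γ).2 hγ.isChain, head?_map_val.2 hγ.head, head?_reverse_map_val.2 hγ.last,
      (hword γ).2 hγ.conj⟩
    rw [Fintype.card_fin]
    exact Nat.pow_le_pow_left (List.toFinset_card_le _) _

theorem conjTest_walk_iff {n : ℕ} {G : SimpleGraph (Fin n)} {u v : Fin n} (p : G.Walk u u)
    (q : G.Walk v v) :
    ConjTest (graphCode G) ((walkCode p).length + (walkCode q).length) (walkCode p).head?
      (walkCode q).head? [(walkCode p, walkCode q)] ↔ WalkConj ⟨u, p⟩ ⟨v, q⟩ := by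
  have h := conjTest_iff G (C := (walkCode p).length + (walkCode q).length) (u := u) (v := v)
    (L := [(p.support, q.support)]) (by simp) (by simp [head?_support])
    (by simp [getLast?_support]) (by simp [walkCode])
  have hu : (walkCode p).head? = some (u : ℕ) := head?_map_val.2 (head?_support p)
  have hv : (walkCode q).head? = some (v : ℕ) := head?_map_val.2 (head?_support q)
  rw [hu, hv]
  refine h.trans ?_
  rw [walkConj_iff]
  constructor
  · rintro ⟨γ, hγ⟩
    obtain ⟨r, rfl⟩ := exists_walk_support_eq hγ.isChain hγ.head hγ.last
    exact ⟨r, hγ.conj 0⟩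
  · rintro ⟨r, hr⟩
    refine ⟨r.support, r.isChain_adj_support, head?_support r, getLast?_support r, fun i => ?_⟩
    obtain rfl : i = 0 := Subsingleton.elim (α := Fin 1) _ _
    exact hr

theorem mapTest_iff {n m : ℕ} {G : SimpleGraph (Fin n)} {H : SimpleGraph (Fin m)}
    (f g : SimplicialMap G H) :
    MapTest (graphCode G) (graphCode H) (mapCode f) (mapCode g) ↔ f.Homotopic g := by
  classical
  rw [simplicialMap_homotopic_iff (C := 2 * n) (by simp), MapTest, length_graphCode,
    Fin.forall_iff]
  refine forall₂_congr fun i hi => ?_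
  let v : Fin n := ⟨i, hi⟩
  let S := (allLists (List.finRange n) (2 * n)).filter fun l =>
    l.IsChain G.Adj ∧ l.head? = some v ∧ l.getLast? = some v
  let L := S.map fun l => (l.map f.toFun, l.map g.toFun)
  have hpairs : loopPairs (graphCode G) (mapCode f) (mapCode g) i =
      L.map (Prod.map (List.map Fin.val) (List.map Fin.val)) := by
    have hval : ∀ (k : SimplicialMap G H) (x : Fin n), (mapCode k).getD x 0 = k.toFun x := by
      intro k x
      simp [mapCode]
    have hloop : ∀ l : List (Fin n), IsLoopCode (l.map Fin.val) (graphCode G, i) ↔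
        (l.IsChain G.Adj ∧ l.head? = some v ∧ l.getLast? = some v) := by
      intro l
      rw [IsLoopCode, isWalkCode_map]
      change _ ∧ _ = some (v : ℕ) ∧ _ = some (v : ℕ) ↔ _
      rw [head?_map_val, head?_reverse_map_val]
    simp only [loopPairs, length_graphCode, allLists_range, List.filter_map, List.map_map, L, S]
    congr 1
    · funext l
      simp only [Function.comp_apply, Prod.map_apply, List.map_map]
      exact Prod.ext (List.map_congr_left fun x _ => hval f x)
        (List.map_congr_left fun x _ => hval g x)
    · congr 1
      funext l
      simp only [Function.comp_apply, hloop]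
  have hf : (mapCode f)[i]? = some (f.toFun v : ℕ) := by simp [mapCode, hi, v]
  have hg : (mapCode g)[i]? = some (g.toFun v : ℕ) := by simp [mapCode, hi, v]
  have hS : ∀ l, l ∈ S ↔ ∃ p : G.Walk v v, p.support.length ≤ 2 * n ∧ p.support = l := by
    intro l
    simp only [S, List.mem_filter, mem_allLists_finRange, decide_eq_true_eq]
    constructor
    · rintro ⟨h1, h2, h3, h4⟩
      obtain ⟨p, rfl⟩ := exists_walk_support_eq h2 h3 h4
      exact ⟨p, h1, rfl⟩
    · rintro ⟨p, h1, rfl⟩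
      exact ⟨h1, p.isChain_adj_support, head?_support p, getLast?_support p⟩
  have hLmem : ∀ pq, pq ∈ L ↔ ∃ p : G.Walk v v, p.support.length ≤ 2 * n ∧
      (p.support.map f.toFun, p.support.map g.toFun) = pq := by
    intro pq
    simp only [L, List.mem_map, hS]
    constructor
    · rintro ⟨_, ⟨p, hp, rfl⟩, h⟩
      exact ⟨p, hp, h⟩
    · rintro ⟨p, hp, h⟩
      exact ⟨_, ⟨p, hp, rfl⟩, h⟩
  -- The one-vertex walk is always listed, as `i < n` gives `1 ≤ 2 * n`; the length bound needs a
  -- nonempty family.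
  have hne : L ≠ [] :=
    List.ne_nil_of_mem ((hLmem _).2 ⟨Walk.nil, by simp; omega, rfl⟩)
  rw [hpairs, hf, hg, conjTest_iff H hne]
  · refine exists_congr fun γ => ⟨IsConjugator.reindex ?_, IsConjugator.reindex ?_⟩
    · rintro ⟨p, hp⟩
      obtain ⟨k, hk, hk'⟩ := List.mem_iff_getElem.1 ((hLmem _).2 ⟨p, hp, rfl⟩)
      exact ⟨⟨k, hk⟩, congrArg Prod.fst hk', congrArg Prod.snd hk'⟩
    · intro k
      obtain ⟨p, hp, h⟩ := (hLmem _).1 (List.getElem_mem k.2)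
      exact ⟨⟨p, hp⟩, congrArg Prod.fst h, congrArg Prod.snd h⟩
  · intro pq hpq
    obtain ⟨p, hp, rfl⟩ := (hLmem _).1 hpq
    simp [head?_support]
  · intro pq hpq
    obtain ⟨p, hp, rfl⟩ := (hLmem _).1 hpq
    simp [getLast?_support]
  · intro pq hpq
    obtain ⟨p, hp, rfl⟩ := (hLmem _).1 hpq
    simpa using hp

end Tests

/-! ### Primitive recursiveness of the tests. -/

section Computability

open Primrec

variable {α β : Type*} [Primcodable α] [Primcodable β]

theorem primrecPred_exists_mem {f : α → List β} (hf : Primrec f) {R : β → α → Prop}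
    (hR : PrimrecRel R) : PrimrecPred fun a => ∃ b ∈ f a, R b a :=
  hR.exists_mem_list.comp hf .id

theorem primrecPred_forall_mem {f : α → List β} (hf : Primrec f) {R : β → α → Prop}
    (hR : PrimrecRel R) : PrimrecPred fun a => ∀ b ∈ f a, R b a :=
  hR.forall_mem_list.comp hf .id

theorem primrecPred_forall_lt {f : α → ℕ} (hf : Primrec f) {R : ℕ → α → Prop}
    (hR : PrimrecRel R) : PrimrecPred fun a => ∀ i < f a, R i a :=
  (primrecPred_forall_mem (list_range.comp hf) hR).of_eq fun a => by simp

theorem primrec_push : Primrec₂ (push : ℕ → List ℕ → List ℕ) := by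
  have : Primrec fun x : ℕ × List ℕ => (List.casesOn x.2 [x.1] fun b t =>
      if x.1 = b then b :: t else if t.head? = some x.1 then t else x.1 :: b :: t : List ℕ) := by
    refine list_casesOn (α := ℕ × List ℕ) (β := ℕ) (σ := List ℕ)
      (h := fun x y => if x.1 = y.1 then y.1 :: y.2 else if y.2.head? = some x.1 then y.2 else
        x.1 :: y.1 :: y.2) snd (list_cons.comp fst (.const ([] : List ℕ))) ?_
    have hb : Primrec fun y : (ℕ × List ℕ) × ℕ × List ℕ => y.2.1 := fst.comp snd
    have ht : Primrec fun y : (ℕ × List ℕ) × ℕ × List ℕ => y.2.2 := snd.comp snd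
    have ha : Primrec fun y : (ℕ × List ℕ) × ℕ × List ℕ => y.1.1 := fst.comp fst
    exact .ite (Primrec.eq.comp ha hb) (list_cons.comp hb ht)
      (.ite (Primrec.eq.comp (list_head?.comp ht) (option_some.comp ha)) ht
        (list_cons.comp ha (list_cons.comp hb ht)))
  refine this.of_eq fun ⟨a, s⟩ => ?_
  cases s <;> rfl

theorem primrec_reduce : Primrec (reduce : List ℕ → List ℕ) :=
  list_foldr .id (.const []) (primrec_push.comp (fst.comp snd) (snd.comp snd)).to₂

theorem primrec_allLists : Primrec₂ (allLists : List ℕ → ℕ → List (List ℕ)) := by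
  have : Primrec₂ fun (vs : List ℕ) (k : ℕ) => (k.rec [[]] fun _ r =>
      [] :: vs.flatMap fun a => r.map (a :: ·) : List (List ℕ)) := by
    refine nat_rec (α := List ℕ) (β := List (List ℕ))
      (g := fun vs y => [] :: vs.flatMap fun a => y.2.map (a :: ·)) (.const [[]]) ?_
    refine list_cons.comp (.const ([] : List ℕ)) (list_flatMap fst ?_)
    exact list_map (snd.comp (snd.comp fst)) (list_cons.comp (snd.comp fst) snd)
  refine this.of_eq fun vs k => ?_
  induction k with
  | zero => rfl
  | succ k ih => exact congrArg (fun r => [] :: vs.flatMap fun a => r.map (a :: ·)) ih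

theorem primrec_pow : Primrec₂ ((· ^ ·) : ℕ → ℕ → ℕ) := Primrec₂.unpaired'.1 Nat.Primrec.pow

theorem primrec_entry : Primrec fun x : List (List Bool) × ℕ × ℕ => entry x.1 x.2.1 x.2.2 :=
  (list_getD false).comp ((list_getD ([] : List Bool)).comp fst (fst.comp snd)) (snd.comp snd)

theorem primrec_isWalkCode : PrimrecRel IsWalkCode := by
  refine primrecPred_forall_lt (nat_sub.comp (list_length.comp snd) (.const 1)) ?_
  refine Primrec.eq.comp (primrec_entry.comp ((fst.comp snd).pair (Primrec.pair ?_ ?_))) (.const true)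
  · exact (list_getD 0).comp (snd.comp snd) fst
  · exact (list_getD 0).comp (snd.comp snd) (Primrec.succ.comp fst)

theorem primrec_isLoopCode : PrimrecRel IsLoopCode := by
  refine PrimrecPred.and (primrec_isWalkCode.comp (fst.comp snd) fst) (PrimrecPred.and ?_ ?_)
  · exact Primrec.eq.comp (list_head?.comp fst) (option_some.comp (snd.comp snd))
  · exact Primrec.eq.comp (list_head?.comp (list_reverse.comp fst)) (option_some.comp (snd.comp snd))

theorem primrec_allLists_range {f g : α → ℕ} (hf : Primrec f) (hg : Primrec g) :
    Primrec fun a => allLists (List.range (f a)) (g a) :=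
  primrec_allLists.comp (list_range.comp hf) hg

theorem primrec_loopPairs : Primrec fun x : (List (List Bool) × ℕ) × List ℕ × List ℕ =>
    loopPairs x.1.1 x.2.1 x.2.2 x.1.2 := by
  classical
  have hlen : Primrec fun x : (List (List Bool) × ℕ) × List ℕ × List ℕ => x.1.1.length :=
    list_length.comp (fst.comp fst)
  refine list_map ((primrec_isLoopCode.listFilter).comp
    (primrec_allLists_range hlen (nat_mul.comp (.const 2) hlen)) fst) ?_
  refine Primrec.pair (list_map snd ?_) (list_map snd ?_)
  · exact (list_getD 0).comp (fst.comp (snd.comp (fst.comp fst))) snd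
  · exact (list_getD 0).comp (snd.comp (snd.comp (fst.comp fst))) snd

theorem primrecPred_conjTest : PrimrecPred fun x : (List (List Bool) × ℕ) ×
    (Option ℕ × Option ℕ) × List (List ℕ × List ℕ) =>
    ConjTest x.1.1 x.1.2 x.2.1.1 x.2.1.2 x.2.2 := by
  have hlen : Primrec fun x : (List (List Bool) × ℕ) ×
      (Option ℕ × Option ℕ) × List (List ℕ × List ℕ) => x.1.1.length :=
    list_length.comp (fst.comp fst)
  refine primrecPred_exists_mem (primrec_allLists_range hlen (primrec_pow.comp
    (list_length.comp (primrec_allLists_range hlen (snd.comp fst)))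
    (list_length.comp (snd.comp snd)))) ?_
  refine PrimrecPred.and (primrec_isWalkCode.comp (fst.comp (fst.comp snd)) fst)
    (PrimrecPred.and ?_ (PrimrecPred.and ?_ ?_))
  · exact Primrec.eq.comp (list_head?.comp fst) (fst.comp (fst.comp (snd.comp snd)))
  · exact Primrec.eq.comp (list_head?.comp (list_reverse.comp fst))
      (snd.comp (fst.comp (snd.comp snd)))
  · refine primrecPred_forall_mem (snd.comp (snd.comp snd)) ?_
    refine Primrec.eq.comp (primrec_reduce.comp ?_) (primrec_reduce.comp (snd.comp fst))
    exact list_append.comp (list_append.comp (list_reverse.comp (fst.comp snd)) (fst.comp fst))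
      (fst.comp snd)

theorem primrecPred_mapTest : PrimrecPred fun x : (List (List Bool) × List (List Bool)) ×
    List ℕ × List ℕ => MapTest x.1.1 x.1.2 x.2.1 x.2.2 := by
  refine primrecPred_forall_lt (list_length.comp (fst.comp fst)) ?_
  have hA : Primrec fun y : ℕ × (List (List Bool) × List (List Bool)) × List ℕ × List ℕ =>
    y.2.1.1 := fst.comp (fst.comp snd)
  have hB : Primrec fun y : ℕ × (List (List Bool) × List (List Bool)) × List ℕ × List ℕ =>
    y.2.1.2 := snd.comp (fst.comp snd)
  have hf : Primrec fun y : ℕ × (List (List Bool) × List (List Bool)) × List ℕ × List ℕ =>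
    y.2.2.1 := fst.comp (snd.comp snd)
  have hg : Primrec fun y : ℕ × (List (List Bool) × List (List Bool)) × List ℕ × List ℕ =>
    y.2.2.2 := snd.comp (snd.comp snd)
  exact primrecPred_conjTest.comp
    ((hB.pair (nat_mul.comp (.const 2) (list_length.comp hA))).pair
      (((list_getElem?.comp hf fst).pair (list_getElem?.comp hg fst)).pair
        (primrec_loopPairs.comp ((hA.pair fst).pair (hf.pair hg)))))

theorem exists_computable_of_primrecPred {p : α → Prop} (hp : PrimrecPred p) :
    ∃ alg : α → Bool, Computable alg ∧ ∀ a, alg a = true ↔ p a := by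
  obtain ⟨_, hp⟩ := hp
  exact ⟨_, hp.to_comp, fun a => decide_eq_true_iff⟩

end Computability

end GraphHomotopy

theorem theorem8p10 :
    -- (a) based homotopy of based oriented cycles in a graph with a basepoint
    (∃ alg : List (List Bool) × List ℕ × List ℕ → Bool, Computable alg ∧
      ∀ (n : ℕ) (G : SimpleGraph (Fin n)) (v : Fin n) (p q : G.Walk v v),
        alg (GraphHomotopy.graphCode G, GraphHomotopy.walkCode p, GraphHomotopy.walkCode q) = true ↔
          GraphHomotopy.BasedHomotopic p q) ∧
    -- (b) free homotopy of oriented cycles in a graph, given by representing closed walks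
    (∃ alg : List (List Bool) × List ℕ × List ℕ → Bool, Computable alg ∧
      ∀ (n : ℕ) (G : SimpleGraph (Fin n)) (u v : Fin n) (p : G.Walk u u) (q : G.Walk v v),
        alg (GraphHomotopy.graphCode G, GraphHomotopy.walkCode p, GraphHomotopy.walkCode q) = true ↔
          (GraphHomotopy.OrientedCycle.mk p).Homotopic (GraphHomotopy.OrientedCycle.mk q)) ∧
    -- (c) homotopy of simplicial maps from one graph to another
    (∃ alg : (List (List Bool) × List (List Bool)) × List ℕ × List ℕ → Bool, Computable alg ∧
      ∀ (n m : ℕ) (G : SimpleGraph (Fin n)) (H : SimpleGraph (Fin m))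
        (f g : GraphHomotopy.SimplicialMap G H),
        alg ((GraphHomotopy.graphCode G, GraphHomotopy.graphCode H),
            GraphHomotopy.mapCode f, GraphHomotopy.mapCode g) = true ↔
          f.Homotopic g) := by
  open GraphHomotopy Primrec in
  refine ⟨?_, ?_, ?_⟩
  · have hp : Primrec fun x : List (List Bool) × List ℕ × List ℕ => x.2.1 := fst.comp snd
    have hq : Primrec fun x : List (List Bool) × List ℕ × List ℕ => x.2.2 := snd.comp snd
    -- Reduction looks only at the letters, so comparing the reduced codes decides based homotopy.
    obtain ⟨alg, h, halg⟩ := exists_computable_of_primrecPred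
      (Primrec.eq.comp (primrec_reduce.comp hp) (primrec_reduce.comp hq))
    refine ⟨alg, h, fun n G v p q => (halg _).trans ?_⟩
    exact (equiv_map_iff Fin.val_injective).trans basedHomotopic_iff.symm
  · have hp : Primrec fun x : List (List Bool) × List ℕ × List ℕ => x.2.1 := fst.comp snd
    have hq : Primrec fun x : List (List Bool) × List ℕ × List ℕ => x.2.2 := snd.comp snd
    obtain ⟨alg, h, halg⟩ := exists_computable_of_primrecPred (primrecPred_conjTest.comp
      ((fst.pair (nat_add.comp (list_length.comp hp) (list_length.comp hq))).pair
        (((list_head?.comp hp).pair (list_head?.comp hq)).pair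
          (list_cons.comp (hp.pair hq) (.const [])))))
    refine ⟨alg, h, fun n G u v p q => (halg _).trans ?_⟩
    exact (conjTest_walk_iff p q).trans orientedCycle_homotopic_iff.symm
  · obtain ⟨alg, h, halg⟩ := exists_computable_of_primrecPred primrecPred_mapTest
    exact ⟨alg, h, fun n m G H f g => (halg _).trans (mapTest_iff f g)⟩
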